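/- Let $d\ge 0$, $\lambda>0$, $\alpha>0$. Let $\mathcal P$ be the set of probability densities $q$ on $\mathbb R^d$ (with respect to Lebesgue measure) with $\int\|\theta\|_2^2\,q\,\mathrm d\theta<\infty$ and $\int |q\log q|\,\mathrm d\theta<\infty$. Let $F:\mathcal P\to\mathbb R$ have a functional derivative $\frac{\delta F}{\delta q}:\mathcal P\times\mathbb R^d\to\mathbb R$, that is, for all $q,q'\in\mathcal P$, $$\frac{\mathrm d}{\mathrm d\epsilon}F(q+\epsilon(q'-q))\Big|_{\epsilon=0^+}=\int\frac{\delta F}{\delta q}(q)(\theta)\,(q'-q)(\theta)\,\mathrm d\theta .$$ Assume: 1. For every $q\in\mathcal P$ the function $\theta\mapsto\frac{\delta F}{\delta q}(q)(\theta)$ is smooth and $Z(q)=\int\exp\big(-\tfrac1\lambda\frac{\delta F}{\delta q}(q)(\theta)\big)\mathrm d\theta<\infty$; there is a constant $C$ with $\big|\frac{\delta F}{\delta q}(q)(\theta)\big|\le C(1+\|\theta\|_2^2)$ for all $q\in\mathcal P$, $\theta\in\mathbb R^d$; and $F$ is convex: $F(q')\ge F(q)+\int\frac{\delta F}{\delta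 q}(q)(\theta)(q'-q)(\theta)\,\mathrm d\theta$ for all $q,q'\in\mathcal P$. 2. For every $q\in\mathcal P$ the proximal Gibbs density $p_q(\theta)=\exp\big(-\tfrac1\lambda\frac{\delta F}{\delta q}(q)(\theta)\big)/Z(q)$ satisfies the log-Sobolev inequality with constant $\alpha$ (the same for all $q$): $$\mathbb E_{p_q}[g^2\log g^2]-\mathbb E_{p_q}[g^2]\log\mathbb E_{p_q}[g^2]\le\frac2\alpha\,\mathbb E_{p_q}[\|\nabla g\|_2^2]$$ for every smooth $g:\mathbb R^d\to\mathbb R$ for which these expectations are finite. Let $\mathcal L(q)=F(q)+\lambda\int q\log q\,\mathrm d\theta$ and let $q_*$ be a minimizer of $\mathcal L$ over $\mathcal P$. Let $(q_t)_{t\ge0}$ be a classical solution in $\mathcal P$ of the nonlinear Fokker–Planck equation $$\frac{\partial q_t}{\partial t}=\nabla\cdot\Big(q_t\nabla\frac{\delta F}{\delta q}(q_t)\Big)+\lambda\Delta q_t ,$$ in the following sense: $q_t\in\mathcal P$ for all $t\ge0$; for $t>0$, $q_t$ is positive and $C^2$ in $\theta$ and the equation holds pointwise; every $t>0$ has a neighbourhood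 on which $\big(1+\|\theta\|_2^2+|\log q_s(\theta)|\big)\big|\partial_s q_s(\theta)\big|$ is bounded, uniformly in $s$, by an integrable function of $\theta$; and as $t\downarrow0$, $\int(1+\|\theta\|_2^2)|q_t-q_0|\,\mathrm d\theta\to0$ and $\int q_t\log q_t\,\mathrm d\theta\to\int q_0\log q_0\,\mathrm d\theta$. Then for all $t\ge0$, $$\mathcal L(q_t)-\mathcal L(q_*)\le e^{-2\alpha\lambda t}\,\big(\mathcal L(q_0)-\mathcal L(q_*)\big).$$ -/

import Mathlib

open MeasureTheory Filter Topology
open scoped Gradient ContDiff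

namespace MeanFieldLangevin

/-- The parameter space `ℝ^d` with its Euclidean norm. -/
abbrev Params (d : ℕ) : Type := EuclideanSpace ℝ (Fin d)

/-- The space `𝒫` of probability densities with respect to Lebesgue measure on `ℝ^d` whose second
moment and entropy are finite (`Real.log 0 = 0`, so that `0 log 0 = 0`). -/
structure IsDensity {d : ℕ} (q : Params d → ℝ) : Prop where
  measurable : Measurable q
  nonneg : ∀ θ, 0 ≤ q θ
  integrable : Integrable q
  integral_eq_one : ∫ θ, q θ = 1
  second_moment : Integrable fun θ => ‖θ‖ ^ 2 * q θ
  entropy : Integrable fun θ => q θ * Real.log (q θ)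

/-- The negative entropy `𝔼_q[log q]`. -/
noncomputable def negEntropy {d : ℕ} (q : Params d → ℝ) : ℝ :=
  ∫ θ, q θ * Real.log (q θ)

/-- The entropy-regularized objective `𝓛(q) = F(q) + λ 𝔼_q[log q]`. -/
noncomputable def objective {d : ℕ} (lam : ℝ) (F : (Params d → ℝ) → ℝ) (q : Params d → ℝ) : ℝ :=
  F q + lam * negEntropy q

/-- The normalization constant `Z(q) = ∫ exp(-λ⁻¹ (δF/δq)(q)(θ)) dθ`, where `dF q θ` stands for
`(δF/δq)(q)(θ)`. -/
noncomputable def normalizer {d : ℕ} (lam : ℝ) (dF : (Params d → ℝ) → Params d → ℝ)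
    (q : Params d → ℝ) : ℝ :=
  ∫ θ, Real.exp (-(1 / lam) * dF q θ)

/-- The density of the proximal Gibbs distribution,
`p_q(θ) = exp(-λ⁻¹ (δF/δq)(q)(θ)) / Z(q)`. -/
noncomputable def proximalGibbs {d : ℕ} (lam : ℝ) (dF : (Params d → ℝ) → Params d → ℝ)
    (q : Params d → ℝ) (θ : Params d) : ℝ :=
  Real.exp (-(1 / lam) * dF q θ) / normalizer lam dF q

/-- `dF` is a functional derivative of `F` on `𝒫`: along each segment from `q` to `q'` in `𝒫`, the
derivative of `F` at `q` is `∫ dF(q) (q' - q)`. The functional `F` is only defined on `𝒫`, so the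
derivative at `ε = 0` is taken within `[0, 1]`; values of `F` and `dF` off `𝒫` are never used. -/
def IsFunctionalDerivative {d : ℕ} (F : (Params d → ℝ) → ℝ)
    (dF : (Params d → ℝ) → Params d → ℝ) : Prop :=
  ∀ q q' : Params d → ℝ, IsDensity q → IsDensity q' →
    HasDerivWithinAt (fun ε : ℝ => F (fun θ => q θ + ε * (q' θ - q θ)))
      (∫ θ, dF q θ * (q' θ - q θ)) (Set.Icc 0 1) 0

/-- `F` is a convex functional on `𝒫` with functional derivative `dF`, which is smooth in `θ`,
is `O(1 + ‖θ‖²)` uniformly over `𝒫`, and has finite normalization constants `Z(q)`. -/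
structure IsSmoothConvexFunctional {d : ℕ} (lam : ℝ) (F : (Params d → ℝ) → ℝ)
    (dF : (Params d → ℝ) → Params d → ℝ) : Prop where
  derivative : IsFunctionalDerivative F dF
  smooth : ∀ q, IsDensity q → ContDiff ℝ ∞ (dF q)
  normalizer_finite : ∀ q, IsDensity q → Integrable fun θ => Real.exp (-(1 / lam) * dF q θ)
  growth : ∃ C : ℝ, ∀ q, IsDensity q → ∀ θ, |dF q θ| ≤ C * (1 + ‖θ‖ ^ 2)
  convex : ∀ q q', IsDensity q → IsDensity q' →
    F q + ∫ θ, dF q θ * (q' θ - q θ) ≤ F q'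

/-- The probability distribution with density `p` satisfies the log-Sobolev inequality with
constant `α`:
`𝔼_p[g² log g²] - 𝔼_p[g²] log 𝔼_p[g²] ≤ (2 / α) 𝔼_p[‖∇g‖²]` for each smooth `g` for which the
three expectations are finite. -/
def LogSobolev {d : ℕ} (α : ℝ) (p : Params d → ℝ) : Prop :=
  ∀ g : Params d → ℝ, ContDiff ℝ ∞ g →
    Integrable (fun θ => g θ ^ 2 * p θ) →
    Integrable (fun θ => g θ ^ 2 * Real.log (g θ ^ 2) * p θ) →
    Integrable (fun θ => ‖∇ g θ‖ ^ 2 * p θ) →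
    (∫ θ, g θ ^ 2 * Real.log (g θ ^ 2) * p θ)
        - (∫ θ, g θ ^ 2 * p θ) * Real.log (∫ θ, g θ ^ 2 * p θ)
      ≤ 2 / α * ∫ θ, ‖∇ g θ‖ ^ 2 * p θ

/-- The divergence of a vector field on `ℝ^d`. -/
noncomputable def divergence {d : ℕ} (v : Params d → Params d) (θ : Params d) : ℝ :=
  ∑ i : Fin d, (fderiv ℝ v θ (EuclideanSpace.single i 1)) i

/-- The right-hand side `∇ · (q ∇(δF/δq)(q)) + λ Δq` of the nonlinear Fokker–Planck equation. -/
noncomputable def fokkerPlanckRHS {d : ℕ} (lam : ℝ) (dF : (Params d → ℝ) → Params d → ℝ)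
    (q : Params d → ℝ) (θ : Params d) : ℝ :=
  divergence (fun x => q x • ∇ (dF q) x) θ + lam * Laplacian.laplacian q θ

/-- `(q_t)_{t ≥ 0}` is a classical solution in `𝒫` of the nonlinear Fokker–Planck equation
`∂q_t/∂t = ∇ · (q_t ∇(δF/δq)(q_t)) + λ Δq_t`. For `t > 0` the density is positive, twice
continuously differentiable in `θ`, and the equation holds pointwise. The time derivative is
dominated, locally uniformly in `t > 0`, with the weight `1 + ‖θ‖² + |log q_t(θ)|`, so that it
makes sense under the integrals that define second moments and entropy. The initial value is
attained in the weighted space `L¹((1 + ‖θ‖²) dθ)` and in entropy; no smoothness or positivity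
of `q_0` is required. -/
structure IsFokkerPlanckFlow {d : ℕ} (lam : ℝ) (dF : (Params d → ℝ) → Params d → ℝ)
    (q : ℝ → Params d → ℝ) : Prop where
  density : ∀ t, 0 ≤ t → IsDensity (q t)
  pos : ∀ t, 0 < t → ∀ θ, 0 < q t θ
  contDiff : ∀ t, 0 < t → ContDiff ℝ 2 (q t)
  equation : ∀ t, 0 < t → ∀ θ, HasDerivAt (fun s => q s θ) (fokkerPlanckRHS lam dF (q t) θ) t
  dominated : ∀ t, 0 < t → ∃ G : Params d → ℝ, Integrable G ∧ ∀ᶠ s in 𝓝 t, ∀ θ,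
    (1 + ‖θ‖ ^ 2 + |Real.log (q s θ)|) * |deriv (fun r => q r θ) s| ≤ G θ
  initial : Tendsto (fun t => ∫ θ, (1 + ‖θ‖ ^ 2) * |q t θ - q 0 θ|) (𝓝[>] 0) (𝓝 0)
  initial_entropy : Tendsto (fun t => negEntropy (q t)) (𝓝[>] 0) (𝓝 (negEntropy (q 0)))

/-- `qstar` is an optimal solution of the problem of minimizing `𝓛` over `𝒫`. -/
def IsOptimal {d : ℕ} (lam : ℝ) (F : (Params d → ℝ) → ℝ) (qstar : Params d → ℝ) : Prop :=
  IsDensity qstar ∧ ∀ q, IsDensity q → objective lam F qstar ≤ objective lam F q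

end MeanFieldLangevin

/-!
The optimality gap `f(t) = 𝓛(q_t) - 𝓛(q_*)` satisfies `f' ≤ -2αλ f` in a one-sided sense. Write
`V = (δF/δq)(q_t)`, let `p` be the proximal Gibbs density of `q_t`, put `u = q_t / p`, and let `w` be
the right-hand side of the equation, which equals `∇ · (λ p ∇u)`.

* *Entropy production.* Formally `f'(t) = ∫ (V + λ log q_t + λ) w = λ ∫ w log u`, the constants
  dropping out because `∫ w = 0`, and integration by parts gives
  `∫ w log u = -λ ∫ p ‖∇u‖² / u` (Fisher information).
* *Log-Sobolev.* With `g = √u` the log-Sobolev inequality bounds the relative entropy of `q_t` with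
  respect to `p` by `1 / (2α)` times that Fisher information (`LogSobolev.relativeEntropy_le`).
* *Entropy sandwich.* By convexity of `F` and nonnegativity of relative entropy,
  `f(t) ≤ λ ∫ q_t log u` (`IsSmoothConvexFunctional.objective_sub_le`).

Three points need care. First, nothing is assumed about how the functional derivative depends on its
density, so `t ↦ F(q_t)` is not known to be differentiable. Convexity, however, bounds its increments
to the left of `t` by those of the differentiable function `s ↦ ∫ V q_s`, and a Grönwall argument
needs only that (`le_exp_mul_of_left_majorant`).

Second, no decay of `∇V` or `∇q_t` is assumed, so the boundary terms at infinity have to be handled.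
Testing the equation with `χ_n² log (u / (k + u))`, where `χ_n` are cutoffs, works: this function
`h(u)` of `u` satisfies `h² ≤ k h'`, so that Young's inequality absorbs the cross term at the price of
`k ∫ p ‖∇χ_n‖²`, which vanishes in the limit because `p` is integrable. Letting `k → ∞`, after
adding `log k` (allowed since `∫ w = 0`), recovers `log u` (`truncated_dissipation`, `dissipation`).
Only the inequality `λ ∫ p ‖∇u‖² / u ≤ -∫ w log u` is obtained, which is the direction needed.

Third, `√u` is only `C²`, whereas the log-Sobolev inequality is assumed for smooth functions;
cutoffs and mollification extend it to `C¹` functions (`LogSobolev.of_contDiff_one`).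
-/

namespace MeanFieldLangevin

/-! ### Grönwall's inequality from one-sided majorants -/

/-- If at each positive time `t` the increments of `f` to the left of `t` are at most those of a
function `A` whose derivative at `t` is at most `-K f(t)`, then `f` decays at the rate `K`.
No derivative of `f` itself is needed. -/
lemma le_exp_mul_of_left_majorant {f : ℝ → ℝ} {K T : ℝ} (hT : 0 ≤ T)
    (hf : ContinuousOn f (Set.Icc 0 T))
    (h : ∀ t, 0 < t → t ≤ T → ∃ (A : ℝ → ℝ) (D : ℝ), HasDerivAt A D t ∧ D ≤ -K * f t ∧
      ∀ s, 0 ≤ s → s < t → f t - f s ≤ A t - A s) :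
    f T ≤ Real.exp (-K * T) * f 0 := by
  -- Reversing time turns the control of left increments into one of right slopes.
  have key := le_gronwallBound_of_liminf_deriv_right_le (f := fun s => -f (T - s))
    (f' := fun s => K * -f (T - s)) (δ := -f T) (K := K) (ε := 0) (a := 0) (b := T)
    ?_ ?_ (by simp) (by intro x _; simp) T ⟨hT, le_rfl⟩
  · rw [gronwallBound_ε0] at key
    simp only [sub_self, sub_zero] at key
    have e : Real.exp (-K * T) * Real.exp (K * T) = 1 := by
      rw [← Real.exp_add]; simp
    have h1 := mul_le_mul_of_nonneg_left key (Real.exp_pos (-K * T)).le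
    rw [show Real.exp (-K * T) * (-f T * Real.exp (K * T))
      = -f T * (Real.exp (-K * T) * Real.exp (K * T)) by ring, e] at h1
    linarith
  · refine (hf.comp (by fun_prop) ?_).neg
    intro s hs
    exact ⟨by linarith [hs.2], by linarith [hs.1]⟩
  · intro x hx r hr
    obtain ⟨A, D, hA, hD, hle⟩ := h (T - x) (by linarith [hx.2]) (by linarith [hx.1])
    have hA' : HasDerivAt (fun z => -A (T - z)) D x := by
      have h1 : HasDerivAt (fun z : ℝ => T - z) (-1) x := by
        simpa using (hasDerivAt_id x).const_sub T
      have h2 : HasDerivAt (fun z => A (T - z)) (D * -1) x := HasDerivAt.comp x hA h1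
      simpa using h2.fun_neg
    have hDr : D < r := lt_of_le_of_lt (by linarith) hr
    have h2 := (hasDerivWithinAt_iff_tendsto_slope' (s := Set.Ioi x) (by simp)).1
      hA'.hasDerivWithinAt
    have h3 := h2.eventually_lt_const hDr
    refine Eventually.frequently ?_
    have h4 : ∀ᶠ z in 𝓝[>] x, z ∈ Set.Ioc x T := Ioc_mem_nhdsGT hx.2
    filter_upwards [h3, h4] with z hz hzT
    refine lt_of_le_of_lt ?_ hz
    rw [slope_def_field, div_eq_inv_mul]
    have hpos : 0 < z - x := by linarith [hzT.1]
    refine mul_le_mul_of_nonneg_left ?_ (inv_nonneg.2 hpos.le)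
    have := hle (T - z) (by linarith [hzT.2]) (by linarith)
    linarith

/-! ### Fatou's lemma, cutoffs and mollification -/

/-- Fatou's lemma in the form: nonnegative functions with converging upper bounds on their
integrals have an integrable limit, whose integral is at most the limit of the bounds. -/
lemma integrable_and_integral_le_of_tendsto {X : Type*} [MeasurableSpace X] {μ : Measure X}
    {f : ℕ → X → ℝ} {g : X → ℝ} {a : ℕ → ℝ} {b : ℝ} (hf : ∀ n, Measurable (f n))
    (hint : ∀ n, Integrable (f n) μ) (h0 : ∀ n x, 0 ≤ f n x)
    (hlim : ∀ x, Tendsto (fun n => f n x) atTop (𝓝 (g x)))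
    (hle : ∀ n, ∫ x, f n x ∂μ ≤ a n) (ha : Tendsto a atTop (𝓝 b)) :
    Integrable g μ ∧ ∫ x, g x ∂μ ≤ b := by
  have hg : Measurable g := measurable_of_tendsto_metrizable hf (tendsto_pi_nhds.2 hlim)
  have hg0 : ∀ x, 0 ≤ g x := fun x => ge_of_tendsto' (hlim x) fun n => h0 n x
  have hb : 0 ≤ b := ge_of_tendsto' ha fun n => (integral_nonneg (h0 n)).trans (hle n)
  have hl : ∫⁻ x, ENNReal.ofReal (g x) ∂μ ≤ ENNReal.ofReal b := by
    have h1 := lintegral_liminf_le (μ := μ) (u := atTop)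
      (f := fun n x => ENNReal.ofReal (f n x)) fun n => (hf n).ennreal_ofReal
    have h2 : ∀ x, liminf (fun n => ENNReal.ofReal (f n x)) atTop = ENNReal.ofReal (g x) :=
      fun x => (ENNReal.tendsto_ofReal (hlim x)).liminf_eq
    simp only [h2] at h1
    refine h1.trans ?_
    rw [← (ENNReal.tendsto_ofReal ha).liminf_eq]
    refine liminf_le_liminf (Eventually.of_forall fun n => ?_)
    rw [← ofReal_integral_eq_lintegral_ofReal (hint n) (Eventually.of_forall (h0 n))]
    exact ENNReal.ofReal_le_ofReal (hle n)
  have hgi : Integrable g μ := by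
    refine ⟨hg.aestronglyMeasurable, ?_⟩
    rw [hasFiniteIntegral_iff_ofReal (Eventually.of_forall hg0)]
    exact hl.trans_lt ENNReal.ofReal_lt_top
  refine ⟨hgi, ?_⟩
  rw [← ofReal_integral_eq_lintegral_ofReal hgi (Eventually.of_forall hg0)] at hl
  exact (ENNReal.ofReal_le_ofReal_iff hb).1 hl

section Approximation

variable {E : Type*} [NormedAddCommGroup E] [InnerProductSpace ℝ E] [FiniteDimensional ℝ E]

/-- Smooth compactly supported cutoffs `χ_n → 1` with gradients of size `O(1 / n)`. -/
lemma exists_cutoff : ∃ (χ : ℕ → E → ℝ) (c : ℝ), (∀ n, ContDiff ℝ ∞ (χ n)) ∧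
    (∀ n, HasCompactSupport (χ n)) ∧ (∀ n x, 0 ≤ χ n x) ∧ (∀ n x, χ n x ≤ 1) ∧
    (∀ n x, ‖fderiv ℝ (χ n) x‖ ≤ c / (n + 1)) ∧
    ∀ x, Tendsto (fun n => χ n x) atTop (𝓝 1) := by
  let φ : ContDiffBump (0 : E) := ⟨1, 2, one_pos, one_lt_two⟩
  have hφ : ContDiff ℝ ∞ φ := φ.contDiff
  have hφs : HasCompactSupport φ := φ.hasCompactSupport
  obtain ⟨c, hc⟩ := (hφs.fderiv (𝕜 := ℝ)).exists_bound_of_continuous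
    (hφ.continuous_fderiv (by simp))
  have hn : ∀ n : ℕ, (0 : ℝ) < ((n : ℝ) + 1)⁻¹ := fun n => by positivity
  refine ⟨fun n x => φ (((n : ℝ) + 1)⁻¹ • x), c, fun n => ?_, fun n => ?_, fun n x => φ.nonneg,
    fun n x => φ.le_one, fun n x => ?_, fun x => ?_⟩
  · exact hφ.comp (contDiff_const_smul _)
  · exact hφs.comp_smul (hn n).ne'
  · have h1 : HasFDerivAt (fun x : E => φ (((n : ℝ) + 1)⁻¹ • x))
        ((fderiv ℝ φ (((n : ℝ) + 1)⁻¹ • x)).comp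
          (((n : ℝ) + 1)⁻¹ • ContinuousLinearMap.id ℝ E)) x := by
      have h2 : HasFDerivAt (fun x : E => ((n : ℝ) + 1)⁻¹ • x)
          (((n : ℝ) + 1)⁻¹ • ContinuousLinearMap.id ℝ E) x := (hasFDerivAt_id x).const_smul _
      exact HasFDerivAt.comp (g := φ) x (hφ.differentiable (by simp) _).hasFDerivAt h2
    rw [h1.fderiv, ContinuousLinearMap.comp_smul, norm_smul, ContinuousLinearMap.comp_id,
      Real.norm_of_nonneg (hn n).le, div_eq_inv_mul]
    exact mul_le_mul_of_nonneg_left (hc _) (hn n).le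
  · have h1 : Tendsto (fun n : ℕ => ((n : ℝ) + 1)⁻¹ • x) atTop (𝓝 ((0 : ℝ) • x)) := by
      refine Tendsto.smul_const ?_ x
      simpa [one_div] using tendsto_one_div_add_atTop_nhds_zero_nat (𝕜 := ℝ)
    have h2 := (φ.continuous.tendsto ((0 : ℝ) • x)).comp h1
    have h3 : φ ((0 : ℝ) • x) = 1 :=
      φ.one_of_mem_closedBall (by simp [φ])
    rw [h3] at h2
    exact h2

/-- Mollified values inherit the bounds that hold within the radius of the mollifier. -/
lemma norm_convolution_normed_le [MeasurableSpace E] [BorelSpace E] {F : Type*}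
    [NormedAddCommGroup F] [NormedSpace ℝ F] [CompleteSpace F] {φ : ContDiffBump (0 : E)} {R : ℝ}
    (hφ : Function.support (φ.normed volume) ⊆ Metric.ball 0 R) {u : E → F} (hu : Continuous u)
    (x : E) (ε : ℝ) (hε : 0 ≤ ε) (hb : ∀ y ∈ Metric.ball x R, ‖u y‖ ≤ ε) :
    ‖convolution (φ.normed volume) u (ContinuousLinearMap.lsmul ℝ ℝ) volume x‖ ≤ ε := by
  simpa using dist_convolution_le (μ := volume) (f := φ.normed volume) (g := u) (x₀ := x)
    (z₀ := 0) hε hφ φ.nonneg_normed φ.integral_normed hu.aestronglyMeasurable (by simpa using hb)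

/-- A compactly supported `C¹` function is a limit of smooth functions, pointwise together with
the derivatives, with common bounds and a common compact support. -/
lemma exists_smooth_approximation [MeasurableSpace E] [BorelSpace E] {g : E → ℝ}
    (hg : ContDiff ℝ 1 g) (hs : HasCompactSupport g) :
    ∃ (f : ℕ → E → ℝ) (K : Set E) (M : ℝ), IsCompact K ∧ (∀ n, ContDiff ℝ ∞ (f n)) ∧
      (∀ n, ∀ x ∉ K, f n x = 0) ∧ (∀ n, ∀ x ∉ K, fderiv ℝ (f n) x = 0) ∧
      (∀ n x, |f n x| ≤ M) ∧ (∀ n x, ‖fderiv ℝ (f n) x‖ ≤ M) ∧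
      (∀ x, Tendsto (fun n => f n x) atTop (𝓝 (g x))) ∧
      ∀ x, Tendsto (fun n => fderiv ℝ (f n) x) atTop (𝓝 (fderiv ℝ g x)) := by
  have hg' : Continuous (fderiv ℝ g) := hg.continuous_fderiv (by simp)
  obtain ⟨M₁, hM₁⟩ := hs.exists_bound_of_continuous hg.continuous
  obtain ⟨M₂, hM₂⟩ := (hs.fderiv (𝕜 := ℝ)).exists_bound_of_continuous hg'
  let φ : ℕ → ContDiffBump (0 : E) := fun n =>
    ⟨((n : ℝ) + 2)⁻¹, ((n : ℝ) + 1)⁻¹, by positivity, by gcongr; norm_num⟩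
  have hr : Tendsto (fun n => (φ n).rOut) atTop (𝓝 0) := by
    simpa [one_div, φ] using tendsto_one_div_add_atTop_nhds_zero_nat (𝕜 := ℝ)
  have hr1 : ∀ n, (φ n).rOut ≤ 1 := fun n => by
    simp only [φ]
    exact inv_le_one_of_one_le₀ (by linarith [n.cast_nonneg (α := ℝ)])
  have hder : ∀ n x, fderiv ℝ (convolution ((φ n).normed volume) g
      (ContinuousLinearMap.lsmul ℝ ℝ) volume) x =
      convolution ((φ n).normed volume) (fderiv ℝ g) (ContinuousLinearMap.lsmul ℝ ℝ) volume x := by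
    intro n x
    have h1 := hs.hasFDerivAt_convolution_right (μ := volume) (ContinuousLinearMap.lsmul ℝ ℝ)
      ((φ n).continuous_normed (μ := volume)).locallyIntegrable hg x
    rw [h1.fderiv]
    unfold convolution
    refine integral_congr_ae (Eventually.of_forall fun t => ?_)
    ext v
    simp [ContinuousLinearMap.precompR_apply]
  have hball : ∀ n, Function.support ((φ n).normed volume) ⊆ Metric.ball 0 1 := fun n => by
    rw [(φ n).support_normed_eq]
    exact Metric.ball_subset_ball (hr1 n)
  have hout : ∀ x ∉ Metric.cthickening 1 (tsupport g), ∀ y ∈ Metric.ball x 1, y ∉ tsupport g := by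
    intro x hx y hy hy'
    exact hx (Metric.mem_cthickening_of_dist_le x y 1 _ hy' (by
      rw [dist_comm]; exact (Metric.mem_ball.1 hy).le))
  refine ⟨fun n => convolution ((φ n).normed volume) g (ContinuousLinearMap.lsmul ℝ ℝ) volume,
    Metric.cthickening 1 (tsupport g), max M₁ M₂, hs.isCompact.cthickening, fun n => ?_,
    fun n x hx => ?_, fun n x hx => ?_, fun n x => ?_, fun n x => ?_, fun x => ?_, fun x => ?_⟩
  · exact (φ n).hasCompactSupport_normed.contDiff_convolution_left (n := ⊤) _
      (φ n).contDiff_normed hg.continuous.locallyIntegrable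
  · have := norm_convolution_normed_le (hball n) hg.continuous x 0 le_rfl fun y hy => by
      rw [image_eq_zero_of_notMem_tsupport (hout x hx y hy), norm_zero]
    exact norm_le_zero_iff.1 this
  · rw [hder]
    have := norm_convolution_normed_le (hball n) hg' x 0 le_rfl fun y hy => by
      have h1 : y ∉ tsupport (fderiv ℝ g) := fun h =>
        hout x hx y hy (tsupport_fderiv_subset ℝ h)
      rw [image_eq_zero_of_notMem_tsupport h1, norm_zero]
    exact norm_le_zero_iff.1 this
  · exact norm_convolution_normed_le (hball n) hg.continuous x _
      (((norm_nonneg _).trans (hM₁ 0)).trans (le_max_left _ _))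
      fun y _ => (hM₁ y).trans (le_max_left _ _)
  · rw [hder]
    exact norm_convolution_normed_le (hball n) hg' x _
      (((norm_nonneg _).trans (hM₂ 0)).trans (le_max_right _ _))
      fun y _ => (hM₂ y).trans (le_max_right _ _)
  · exact ContDiffBump.convolution_tendsto_right_of_continuous hr hg.continuous x
  · simp only [hder]
    exact ContDiffBump.convolution_tendsto_right_of_continuous hr hg' x

end Approximation

/-! ### The log-Sobolev inequality for `C¹` functions -/

lemma norm_gradient_eq {d : ℕ} (g : Params d → ℝ) (x : Params d) :
    ‖∇ g x‖ = ‖fderiv ℝ g x‖ := by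
  simp [gradient]

lemma tendsto_integral_mul_of_bounded_of_compact {d : ℕ} {ψ : ℕ → Params d → ℝ}
    {ψ' p : Params d → ℝ} {K : Set (Params d)} {c : ℝ} (hK : IsCompact K) (hp : Continuous p)
    (hψ : ∀ n, Continuous (ψ n)) (h0 : ∀ n, ∀ x ∉ K, ψ n x = 0) (hc : ∀ n x, |ψ n x| ≤ c)
    (hlim : ∀ x, Tendsto (fun n => ψ n x) atTop (𝓝 (ψ' x))) :
    (∀ n, Integrable fun x => ψ n x * p x) ∧
      Tendsto (fun n => ∫ x, ψ n x * p x) atTop (𝓝 (∫ x, ψ' x * p x)) := by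
  have hb : Integrable (K.indicator fun x => c * |p x|) := by
    rw [integrable_indicator_iff hK.measurableSet]
    exact (by fun_prop : Continuous fun x => c * |p x|).continuousOn.integrableOn_compact hK
  have hle : ∀ n x, ‖ψ n x * p x‖ ≤ K.indicator (fun x => c * |p x|) x := by
    intro n x
    by_cases hx : x ∈ K
    · rw [Set.indicator_of_mem hx, norm_mul]
      exact mul_le_mul_of_nonneg_right (hc n x) (abs_nonneg _)
    · simp [h0 n x hx, hx]
  have hm : ∀ n, AEStronglyMeasurable (fun x => ψ n x * p x) volume := fun n =>
    ((hψ n).mul hp).aestronglyMeasurable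
  exact ⟨fun n => hb.mono' (hm n) (Eventually.of_forall (hle n)),
    tendsto_integral_of_dominated_convergence _ hm hb (fun n => Eventually.of_forall (hle n))
      (Eventually.of_forall fun x => (hlim x).mul_const _)⟩

/-- The log-Sobolev inequality survives limits in which the three expectations converge. -/
lemma log_sobolev_of_tendsto {d : ℕ} {α : ℝ} {p : Params d → ℝ} {f : ℕ → Params d → ℝ}
    {g : Params d → ℝ}
    (hf : ∀ n, (∫ θ, f n θ ^ 2 * Real.log (f n θ ^ 2) * p θ)
        - (∫ θ, f n θ ^ 2 * p θ) * Real.log (∫ θ, f n θ ^ 2 * p θ)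
      ≤ 2 / α * ∫ θ, ‖fderiv ℝ (f n) θ‖ ^ 2 * p θ)
    (h1 : Tendsto (fun n => ∫ θ, f n θ ^ 2 * p θ) atTop (𝓝 (∫ θ, g θ ^ 2 * p θ)))
    (h2 : Tendsto (fun n => ∫ θ, f n θ ^ 2 * Real.log (f n θ ^ 2) * p θ) atTop
      (𝓝 (∫ θ, g θ ^ 2 * Real.log (g θ ^ 2) * p θ)))
    (h3 : Tendsto (fun n => ∫ θ, ‖fderiv ℝ (f n) θ‖ ^ 2 * p θ) atTop
      (𝓝 (∫ θ, ‖fderiv ℝ g θ‖ ^ 2 * p θ))) :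
    (∫ θ, g θ ^ 2 * Real.log (g θ ^ 2) * p θ)
        - (∫ θ, g θ ^ 2 * p θ) * Real.log (∫ θ, g θ ^ 2 * p θ)
      ≤ 2 / α * ∫ θ, ‖fderiv ℝ g θ‖ ^ 2 * p θ :=
  le_of_tendsto_of_tendsto' (h2.sub ((Real.continuous_mul_log.tendsto _).comp h1))
    (h3.const_mul _) hf

lemma LogSobolev.of_hasCompactSupport {d : ℕ} {α : ℝ} {p : Params d → ℝ} (h : LogSobolev α p)
    (hp : Continuous p) {g : Params d → ℝ} (hg : ContDiff ℝ 1 g) (hs : HasCompactSupport g) :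
    (∫ θ, g θ ^ 2 * Real.log (g θ ^ 2) * p θ)
        - (∫ θ, g θ ^ 2 * p θ) * Real.log (∫ θ, g θ ^ 2 * p θ)
      ≤ 2 / α * ∫ θ, ‖fderiv ℝ g θ‖ ^ 2 * p θ := by
  obtain ⟨f, K, M, hK, hf, hf0, hf0', hfM, hfM', hlim, hlim'⟩ := exists_smooth_approximation hg hs
  have hxlog : Continuous fun y : ℝ => y * Real.log y := Real.continuous_mul_log
  obtain ⟨B, hB⟩ := (isCompact_Icc (a := (0 : ℝ)) (b := M ^ 2)).exists_bound_of_continuousOn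
    hxlog.continuousOn
  have hsq : ∀ n x, f n x ^ 2 ≤ M ^ 2 := fun n x => sq_le_sq.2 ((hfM n x).trans (le_abs_self M))
  have hfc : ∀ n, Continuous (f n) := fun n => (hf n).continuous
  have hfc' : ∀ n, Continuous (fderiv ℝ (f n)) := fun n => (hf n).continuous_fderiv (by simp)
  obtain ⟨i1, t1⟩ := tendsto_integral_mul_of_bounded_of_compact (ψ := fun n x => f n x ^ 2)
    (ψ' := fun x => g x ^ 2) (c := M ^ 2) hK hp (fun n => by fun_prop)
    (fun n x hx => by simp [hf0 n x hx])
    (fun n x => by rw [abs_of_nonneg (sq_nonneg _)]; exact hsq n x)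
    (fun x => (hlim x).pow 2)
  obtain ⟨i2, t2⟩ := tendsto_integral_mul_of_bounded_of_compact
    (ψ := fun n x => f n x ^ 2 * Real.log (f n x ^ 2))
    (ψ' := fun x => g x ^ 2 * Real.log (g x ^ 2)) (c := B) hK hp
    (fun n => hxlog.comp ((hfc n).pow 2))
    (fun n x hx => by simp [hf0 n x hx])
    (fun n x => hB _ ⟨sq_nonneg _, hsq n x⟩)
    (fun x => (hxlog.tendsto _).comp ((hlim x).pow 2))
  obtain ⟨i3, t3⟩ := tendsto_integral_mul_of_bounded_of_compact
    (ψ := fun n x => ‖fderiv ℝ (f n) x‖ ^ 2)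
    (ψ' := fun x => ‖fderiv ℝ g x‖ ^ 2) (c := M ^ 2) hK hp (fun n => by fun_prop)
    (fun n x hx => by simp [hf0' n x hx])
    (fun n x => by
      rw [abs_of_nonneg (sq_nonneg _)]
      exact pow_le_pow_left₀ (norm_nonneg _) (hfM' n x) 2)
    (fun x => (hlim' x).norm.pow 2)
  refine log_sobolev_of_tendsto (fun n => ?_) t1 t2 t3
  have := h (f n) (hf n) (i1 n) (i2 n) (by simpa only [norm_gradient_eq] using i3 n)
  simpa only [norm_gradient_eq] using this

/-- A log-Sobolev inequality for smooth functions extends to all `C¹` functions with finite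
expectations. -/
lemma LogSobolev.of_contDiff_one {d : ℕ} {α : ℝ} {p : Params d → ℝ} (h : LogSobolev α p)
    (hp : Continuous p) (hp0 : ∀ x, 0 ≤ p x) {g : Params d → ℝ} (hg : ContDiff ℝ 1 g)
    (i1 : Integrable fun θ => g θ ^ 2 * p θ)
    (i2 : Integrable fun θ => g θ ^ 2 * Real.log (g θ ^ 2) * p θ)
    (i3 : Integrable fun θ => ‖fderiv ℝ g θ‖ ^ 2 * p θ) :
    (∫ θ, g θ ^ 2 * Real.log (g θ ^ 2) * p θ)
        - (∫ θ, g θ ^ 2 * p θ) * Real.log (∫ θ, g θ ^ 2 * p θ)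
      ≤ 2 / α * ∫ θ, ‖fderiv ℝ g θ‖ ^ 2 * p θ := by
  obtain ⟨χ, c, hχ, hχs, hχ0, hχ1, hχc, hχt⟩ := exists_cutoff (E := Params d)
  have hxlog : Continuous fun y : ℝ => y * Real.log y := Real.continuous_mul_log
  have hc : 0 ≤ c := by simpa using (norm_nonneg _).trans (hχc 0 0)
  have hχc' : ∀ n x, ‖fderiv ℝ (χ n) x‖ ≤ c := fun n x =>
    (hχc n x).trans (div_le_self hc (by linarith [n.cast_nonneg (α := ℝ)]))
  have hprod : ∀ n, ContDiff ℝ 1 fun x => χ n x * g x := fun n => ((hχ n).of_le (by simp)).mul hg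
  have hfd : ∀ n x, fderiv ℝ (fun x => χ n x * g x) x =
      χ n x • fderiv ℝ g x + g x • fderiv ℝ (χ n) x := fun n x =>
    fderiv_fun_mul ((hχ n).differentiable (by simp) x) (hg.differentiable (by simp) x)
  have hlim : ∀ x, Tendsto (fun n => χ n x * g x) atTop (𝓝 (g x)) := fun x => by
    simpa using (hχt x).mul_const (g x)
  have hlim' : ∀ x, Tendsto (fun n => fderiv ℝ (fun x => χ n x * g x) x) atTop
      (𝓝 (fderiv ℝ g x)) := fun x => by
    simp only [hfd]
    have h0 : Tendsto (fun n => fderiv ℝ (χ n) x) atTop (𝓝 0) := by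
      refine squeeze_zero_norm (fun n => hχc n x) ?_
      simpa [div_eq_mul_inv, one_div] using
        (tendsto_one_div_add_atTop_nhds_zero_nat (𝕜 := ℝ)).const_mul c
    simpa using ((hχt x).smul_const (fderiv ℝ g x)).add (h0.const_smul (g x))
  have hχsq : ∀ n x, χ n x ^ 2 ≤ 1 := fun n x => pow_le_one₀ (hχ0 n x) (hχ1 n x)
  refine log_sobolev_of_tendsto (f := fun n x => χ n x * g x)
    (fun n => h.of_hasCompactSupport hp (hprod n) (hχs n).mul_right) ?_ ?_ ?_
  · refine tendsto_integral_of_dominated_convergence (fun θ => g θ ^ 2 * p θ) (fun n => ?_) i1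
      (fun n => Eventually.of_forall fun x => ?_)
      (Eventually.of_forall fun x => ((hlim x).pow 2).mul_const _)
    · exact (((hprod n).continuous.pow 2).mul hp).aestronglyMeasurable
    · rw [Real.norm_of_nonneg (mul_nonneg (sq_nonneg _) (hp0 x)), mul_pow]
      exact mul_le_mul_of_nonneg_right
        (mul_le_of_le_one_left (sq_nonneg _) (hχsq n x)) (hp0 x)
  · refine tendsto_integral_of_dominated_convergence
      (fun θ => ‖g θ ^ 2 * Real.log (g θ ^ 2) * p θ‖ + g θ ^ 2 * p θ) (fun n => ?_)
      (i2.norm.add i1) (fun n => Eventually.of_forall fun x => ?_)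
      (Eventually.of_forall fun x => ((hxlog.tendsto _).comp ((hlim x).pow 2)).mul_const _)
    · exact ((hxlog.comp ((hprod n).continuous.pow 2)).mul hp).aestronglyMeasurable
    · -- `|s a log (s a)| ≤ |a log a| + a` for `0 ≤ s ≤ 1` and `0 ≤ a`
      have h1 := Real.negMulLog_mul (χ n x ^ 2) (g x ^ 2)
      have h2 : |Real.negMulLog (χ n x ^ 2)| ≤ 1 := by
        rw [Real.negMulLog, neg_mul, abs_neg]
        rcases (sq_nonneg (χ n x)).eq_or_lt with h3 | h3
        · simp [← h3]
        · rw [mul_comm]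
          exact (Real.abs_log_mul_self_lt _ h3 (hχsq n x)).le
      simp only [Real.negMulLog, ← mul_pow] at h1 h2
      rw [norm_mul, norm_mul _ (p x), Real.norm_of_nonneg (hp0 x), ← add_mul]
      refine mul_le_mul_of_nonneg_right ?_ (hp0 x)
      rw [Real.norm_eq_abs, Real.norm_eq_abs, ← abs_neg, ← neg_mul, h1]
      refine (abs_add_le _ _).trans ?_
      rw [abs_mul, abs_mul (χ n x ^ 2), abs_of_nonneg (sq_nonneg (g x)),
        abs_of_nonneg (sq_nonneg (χ n x)), neg_mul (g x ^ 2), abs_neg, add_comm]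
      exact add_le_add (mul_le_of_le_one_left (abs_nonneg _) (hχsq n x))
        (mul_le_of_le_one_right (sq_nonneg _) h2)
  · refine tendsto_integral_of_dominated_convergence
      (fun θ => 2 * (‖fderiv ℝ g θ‖ ^ 2 * p θ) + 2 * c ^ 2 * (g θ ^ 2 * p θ)) (fun n => ?_)
      ((i3.const_mul _).add (i1.const_mul _)) (fun n => Eventually.of_forall fun x => ?_)
      (Eventually.of_forall fun x => ((hlim' x).norm.pow 2).mul_const _)
    · exact ((((hprod n).continuous_fderiv (by simp)).norm.pow 2).mul hp).aestronglyMeasurable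
    · rw [Real.norm_of_nonneg (mul_nonneg (sq_nonneg _) (hp0 x)), hfd, ← mul_assoc, ← mul_assoc,
        ← add_mul]
      refine mul_le_mul_of_nonneg_right ?_ (hp0 x)
      have h1 : ‖χ n x • fderiv ℝ g x + g x • fderiv ℝ (χ n) x‖ ≤
          ‖fderiv ℝ g x‖ + |g x| * c := by
        refine (norm_add_le _ _).trans (add_le_add ?_ ?_)
        · rw [norm_smul, Real.norm_of_nonneg (hχ0 n x)]
          exact mul_le_of_le_one_left (norm_nonneg _) (hχ1 n x)
        · rw [norm_smul, Real.norm_eq_abs]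
          exact mul_le_mul_of_nonneg_left (hχc' n x) (abs_nonneg _)
      refine (pow_le_pow_left₀ (norm_nonneg _) h1 2).trans ?_
      have h2 := sq_abs (g x)
      nlinarith [sq_nonneg (‖fderiv ℝ g x‖ - |g x| * c)]

/-! ### The divergence form of the equation -/

lemma contDiff_gradient {d : ℕ} {n : WithTop ℕ∞} {f : Params d → ℝ} (hf : ContDiff ℝ (n + 1) f) :
    ContDiff ℝ n fun x => ∇ f x :=
  (InnerProductSpace.toDual ℝ (Params d)).symm.contDiff.comp (hf.fderiv_right le_rfl)

lemma fderiv_coord {d : ℕ} {v : Params d → Params d} {x : Params d}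
    (hv : DifferentiableAt ℝ v x) (i : Fin d) (e : Params d) :
    fderiv ℝ (fun y => v y i) x e = fderiv ℝ v x e i := by
  have : HasFDerivAt (fun x => v x i) ((EuclideanSpace.proj (𝕜 := ℝ) i).comp (fderiv ℝ v x)) x :=
    (EuclideanSpace.proj (𝕜 := ℝ) i).hasFDerivAt.comp x hv.hasFDerivAt
  rw [this.fderiv]; simp

lemma divergence_add {d : ℕ} {v w : Params d → Params d} {x : Params d}
    (hv : DifferentiableAt ℝ v x) (hw : DifferentiableAt ℝ w x) :
    divergence (fun y => v y + w y) x = divergence v x + divergence w x := by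
  simp [divergence, fderiv_fun_add hv hw, Finset.sum_add_distrib]

lemma divergence_const_smul {d : ℕ} {v : Params d → Params d} {x : Params d} (c : ℝ)
    (hv : DifferentiableAt ℝ v x) :
    divergence (fun y => c • v y) x = c * divergence v x := by
  simp [divergence, fderiv_fun_const_smul hv, Finset.mul_sum]

lemma divergence_gradient {d : ℕ} {f : Params d → ℝ} (hf : ContDiff ℝ 2 f) (x : Params d) :
    divergence (fun y => ∇ f y) x = Laplacian.laplacian f x := by
  rw [InnerProductSpace.laplacian_eq_iteratedFDeriv_orthonormalBasis f
    (EuclideanSpace.basisFun (Fin d) ℝ)]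
  simp only [divergence]
  refine Finset.sum_congr rfl fun i _ => ?_
  have h1 : (fun y => (∇ f y) i) = fun y => fderiv ℝ f y (EuclideanSpace.single i 1) := by
    ext y
    rw [← inner_gradient_left, EuclideanSpace.inner_single_right]
    simp
  have h2 : DifferentiableAt ℝ (fderiv ℝ f) x :=
    (hf.fderiv_right (m := 1) le_rfl).differentiable (by simp) x
  rw [← fderiv_coord ((contDiff_gradient (n := 1) hf).differentiable (by simp) x) i, h1,
    iteratedFDeriv_two_apply, fderiv_clm_apply h2 (differentiableAt_const _)]
  simp

lemma continuous_divergence {d : ℕ} {v : Params d → Params d} (hv : ContDiff ℝ 1 v) :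
    Continuous (divergence v) := by
  have h := hv.continuous_fderiv (by simp)
  unfold divergence
  fun_prop

/-- Integration by parts against a compactly supported function. -/
lemma integral_mul_divergence {d : ℕ} {φ : Params d → ℝ} {v : Params d → Params d}
    (hφ : ContDiff ℝ 1 φ) (hs : HasCompactSupport φ) (hv : ContDiff ℝ 1 v) :
    ∫ x, φ x * divergence v x = -∫ x, fderiv ℝ φ x (v x) := by
  have hφ' := hφ.continuous_fderiv (by simp)
  have hv' := hv.continuous_fderiv (by simp)
  have hφc := hφ.continuous
  have hvc := hv.continuous
  let e : Fin d → Params d := fun i => EuclideanSpace.single i 1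
  have hvi : ∀ i, ContDiff ℝ 1 fun x => v x i := fun i =>
    (EuclideanSpace.proj (𝕜 := ℝ) i).contDiff.comp hv
  have hdi : ∀ i x, fderiv ℝ (fun x => v x i) x (e i) = fderiv ℝ v x (e i) i := fun i x =>
    fderiv_coord (hv.differentiable (by simp) x) i (e i)
  have hsum : ∀ x, fderiv ℝ φ x (v x) = ∑ i, fderiv ℝ φ x (e i) * v x i := fun x => by
    conv_lhs => rw [← (EuclideanSpace.basisFun (Fin d) ℝ).sum_repr (v x)]
    simp [map_sum, e, mul_comm]
  have i1 : ∀ i, Integrable fun x => φ x * fderiv ℝ (fun x => v x i) x (e i) := fun i => by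
    have := (hvi i).continuous_fderiv (by simp)
    exact Continuous.integrable_of_hasCompactSupport (by fun_prop) hs.mul_right
  have i2 : ∀ i, Integrable fun x => fderiv ℝ φ x (e i) * v x i := fun i => by
    refine Continuous.integrable_of_hasCompactSupport (by fun_prop) ?_
    exact (hs.fderiv_apply (𝕜 := ℝ) (e i)).mul_right
  have i3 : ∀ i, Integrable fun x => φ x * v x i := fun i =>
    Continuous.integrable_of_hasCompactSupport (by fun_prop) hs.mul_right
  have hdiv : ∀ x, φ x * divergence v x = ∑ i, φ x * fderiv ℝ (fun x => v x i) x (e i) := by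
    intro x
    simp only [hdi]
    rw [divergence, Finset.mul_sum]
  simp only [hsum, hdiv]
  rw [integral_finsetSum _ fun i _ => i1 i, integral_finsetSum _ fun i _ => i2 i,
    ← Finset.sum_neg_distrib]
  refine Finset.sum_congr rfl fun i _ => ?_
  exact integral_mul_fderiv_eq_neg_fderiv_mul_of_integrable (i2 i) (i1 i) (i3 i)
    (fun x _ => hφ.differentiable (by simp) x) (fun x _ => (hvi i).differentiable (by simp) x)

/-! ### Dissipation of relative entropy -/

/-- With `h(s) = log (s / (k + s))` this reads `h² ≤ k h'`: the function `h` is increasing, yet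
flat enough at both ends for the cross term in the energy estimate to be absorbed. -/
lemma sq_log_sub_log_le {k s : ℝ} (hk : 0 < k) (hs : 0 < s) :
    (Real.log s - Real.log (k + s)) ^ 2 ≤ k * (k / (s * (k + s))) := by
  have hks : 0 < k + s := by positivity
  set t := (Real.log (k + s) - Real.log s) / 2 with ht
  have ht0 : 0 ≤ t := by
    have := Real.log_le_log hs (by linarith : s ≤ k + s)
    rw [ht]; linarith
  have h1 : t ≤ Real.sinh t := Real.self_le_sinh_iff.2 ht0
  rw [Real.sinh_eq] at h1
  have e1 : Real.exp t ^ 2 = (k + s) / s := by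
    rw [← Real.exp_nat_mul, ht]
    push_cast
    rw [mul_div_cancel₀ _ (two_ne_zero), Real.exp_sub, Real.exp_log hks, Real.exp_log hs]
  have e2 : Real.exp (-t) ^ 2 = s / (k + s) := by
    rw [Real.exp_neg, inv_pow, e1, inv_div]
  have e3 : Real.exp t * Real.exp (-t) = 1 := by rw [← Real.exp_add]; simp
  have h2 : (2 * t) ^ 2 ≤ (Real.exp t - Real.exp (-t)) ^ 2 :=
    pow_le_pow_left₀ (by positivity) (by linarith) 2
  have e4 : (Real.exp t - Real.exp (-t)) ^ 2 = k * (k / (s * (k + s))) := by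
    rw [sub_sq, e1, e2, mul_assoc, e3]
    field_simp
    ring
  rw [e4] at h2
  calc _ = (2 * t) ^ 2 := by rw [ht]; ring
    _ ≤ _ := h2

lemma log_one_add_le {s : ℝ} (hs : 0 < s) : Real.log (1 + s) ≤ Real.log 2 + |Real.log s| := by
  rcases le_total s 1 with h | h
  · have := Real.log_le_log (by linarith) (by linarith : 1 + s ≤ 2)
    linarith [abs_nonneg (Real.log s)]
  · have := Real.log_le_log (by linarith) (by linarith : 1 + s ≤ 2 * s)
    rw [Real.log_mul two_ne_zero hs.ne'] at this
    linarith [le_abs_self (Real.log s)]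

/-- Relative entropy dissipation for `w = ∇ · (λ p ∇u)`, tested with the truncated logarithm
`log (u / (k + u))`. -/
lemma truncated_dissipation {d : ℕ} {lam k : ℝ} (hlam : 0 < lam) (hk : 0 < k)
    {p u : Params d → ℝ} (hp : ContDiff ℝ 1 p) (hp0 : ∀ x, 0 ≤ p x) (hpi : Integrable p)
    (hu : ContDiff ℝ 2 u) (hu0 : ∀ x, 0 < u x)
    (hwi : Integrable fun x => (Real.log (u x) - Real.log (k + u x)) *
      divergence (fun y => (lam * p y) • ∇ u y) x) :
    Integrable (fun x => k / (u x * (k + u x)) * ‖fderiv ℝ u x‖ ^ 2 * p x) ∧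
      ∫ x, k / (u x * (k + u x)) * ‖fderiv ℝ u x‖ ^ 2 * p x ≤
        -(1 / lam) * ∫ x, (Real.log (u x) - Real.log (k + u x)) *
          divergence (fun y => (lam * p y) • ∇ u y) x := by
  obtain ⟨χ, c, hχ, hχs, hχ0, hχ1, hχc, hχt⟩ := exists_cutoff (E := Params d)
  set v : Params d → Params d := fun y => (lam * p y) • ∇ u y with hv
  set h : Params d → ℝ := fun x => Real.log (u x) - Real.log (k + u x) with hh
  have hc : 0 ≤ c := by simpa using (norm_nonneg _).trans (hχc 0 0)
  have hku : ∀ x, 0 < k + u x := fun x => add_pos hk (hu0 x)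
  have hu1 : ContDiff ℝ 1 u := hu.of_le (by norm_num)
  have hv1 : ContDiff ℝ 1 v := (contDiff_const.mul hp).smul (contDiff_gradient hu)
  have hh1 : ContDiff ℝ 1 h :=
    (hu1.log fun x => (hu0 x).ne').sub ((contDiff_const.add hu1).log fun x => (hku x).ne')
  have hhd : ∀ x, HasFDerivAt h ((k / (u x * (k + u x))) • fderiv ℝ u x) x := fun x => by
    have hux := (hu1.differentiable (by simp) x).hasFDerivAt
    refine ((hux.log (hu0 x).ne').sub ((hux.const_add k).log (hku x).ne')).congr_fderiv ?_
    rw [← sub_smul]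
    congr 1
    have := (hu0 x).ne'
    have := (hku x).ne'
    field_simp
    ring
  have hφ1 : ∀ n, ContDiff ℝ 1 fun x => χ n x ^ 2 * h x := fun n =>
    (((hχ n).of_le (by simp)).pow 2).mul hh1
  have hφs : ∀ n, HasCompactSupport fun x => χ n x ^ 2 * h x := fun n => 
    (hχs n).mono fun x hx hx' => hx (by simp [hx'])
  have hφd : ∀ n x, fderiv ℝ (fun x => χ n x ^ 2 * h x) x (∇ u x) =
      χ n x ^ 2 * (k / (u x * (k + u x))) * ‖fderiv ℝ u x‖ ^ 2 +
        2 * χ n x * h x * fderiv ℝ (χ n) x (∇ u x) := fun n x => by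
    have h1 := ((((hχ n).differentiable (by simp) x).hasFDerivAt).pow 2).mul (hhd x)
    have h2 : fderiv ℝ u x (∇ u x) = ‖fderiv ℝ u x‖ ^ 2 := by
      rw [← inner_gradient_left, real_inner_self_eq_norm_sq, norm_gradient_eq]
    have h3 := h1.fderiv
    simp only [Pi.mul_def] at h3
    rw [h3]
    simp [h2]
    ring
  have hu' := hu1.continuous_fderiv (by simp)
  have hgu : Continuous fun x => ∇ u x := (contDiff_gradient (n := 1) hu).continuous
  have huc := hu1.continuous
  have hpc := hp.continuous
  have hf0 : ∀ x, 0 ≤ k / (u x * (k + u x)) * ‖fderiv ℝ u x‖ ^ 2 * p x := fun x =>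
    mul_nonneg (mul_nonneg (div_nonneg hk.le (mul_pos (hu0 x) (hku x)).le) (sq_nonneg _)) (hp0 x)
  have hfc : Continuous fun x => k / (u x * (k + u x)) * ‖fderiv ℝ u x‖ ^ 2 * p x := by
    refine ((continuous_const.div (by fun_prop) fun x => ?_).mul (by fun_prop)).mul hpc
    exact (mul_pos (hu0 x) (hku x)).ne'
  have hn : ∀ n : ℕ, (0 : ℝ) < n + 1 := fun n => by positivity
  have hε : ∀ n : ℕ, 0 ≤ 1 - 1 / ((n : ℝ) + 1) := fun n => by
    rw [sub_nonneg, div_le_one (hn n)]; linarith [n.cast_nonneg (α := ℝ)]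
  have hε0 := tendsto_one_div_add_atTop_nhds_zero_nat (𝕜 := ℝ)
  -- Young's inequality with parameter `1 / (n + 1)` for the term with the gradient of the cutoff
  have key : ∀ (n : ℕ) x, (1 - 1 / ((n : ℝ) + 1)) *
      (χ n x ^ 2 * (k / (u x * (k + u x)) * ‖fderiv ℝ u x‖ ^ 2 * p x)) ≤
      fderiv ℝ (fun x => χ n x ^ 2 * h x) x (∇ u x) * p x +
        k * c ^ 2 * (1 / ((n : ℝ) + 1)) * p x := by
    intro n x
    rw [hφd]
    set a := k / (u x * (k + u x)) with ha
    have ha0 : 0 ≤ a := div_nonneg hk.le (mul_pos (hu0 x) (hku x)).le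
    set N := ‖fderiv ℝ u x‖ with hN
    have hN0 : 0 ≤ N := norm_nonneg _
    set m : ℝ := (n : ℝ) + 1 with hm
    have hm0 : 0 < m := hn n
    have h1 : |fderiv ℝ (χ n) x (∇ u x)| ≤ c / m * N := by
      have := (fderiv ℝ (χ n) x).le_of_opNorm_le (hχc n x) (∇ u x)
      rwa [norm_gradient_eq] at this
    have h2 : h x ^ 2 ≤ k * a := sq_log_sub_log_le hk (hu0 x)
    have h3 : |2 * χ n x * h x * fderiv ℝ (χ n) x (∇ u x)| ≤
        1 / m * (χ n x ^ 2 * a * N ^ 2) + k * c ^ 2 * (1 / m) := by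
      have hha : |h x| ≤ Real.sqrt k * Real.sqrt a := by
        rw [← Real.sqrt_mul hk.le]; exact Real.abs_le_sqrt h2
      rw [abs_mul, abs_mul, abs_mul, abs_two, abs_of_nonneg (hχ0 n x)]
      have h4 : 2 * χ n x * |h x| * |fderiv ℝ (χ n) x (∇ u x)| ≤
          2 * χ n x * (Real.sqrt k * Real.sqrt a) * (c / m * N) := by
        have := hχ0 n x
        gcongr
      refine h4.trans ?_
      have h5 : 0 ≤ 1 / m * (χ n x * Real.sqrt a * N - Real.sqrt k * c) ^ 2 := by positivity
      have e1 := Real.sq_sqrt ha0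
      have e2 := Real.sq_sqrt hk.le
      calc _ = 1 / m * (χ n x ^ 2 * Real.sqrt a ^ 2 * N ^ 2) + Real.sqrt k ^ 2 * c ^ 2 * (1 / m) -
            1 / m * (χ n x * Real.sqrt a * N - Real.sqrt k * c) ^ 2 := by ring
        _ ≤ _ := by rw [e1, e2]; linarith
    have h4 := neg_le_of_abs_le h3
    have h5 := mul_nonneg (sub_nonneg.2 h4) (hp0 x)
    linarith
  have i1 : ∀ n : ℕ, Integrable fun x => (1 - 1 / ((n : ℝ) + 1)) *
      (χ n x ^ 2 * (k / (u x * (k + u x)) * ‖fderiv ℝ u x‖ ^ 2 * p x)) := fun n => by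
    have hχn := (hχ n).continuous
    refine (Continuous.integrable_of_hasCompactSupport ((hχn.pow 2).mul hfc) ?_).const_mul _
    exact (hχs n).mono fun x hx hx' => hx (by simp [hx'])
  have i2 : ∀ n, Integrable fun x => fderiv ℝ (fun x => χ n x ^ 2 * h x) x (∇ u x) * p x := by
    intro n
    have h1 := (hφ1 n).continuous_fderiv (by simp)
    refine Continuous.integrable_of_hasCompactSupport (by fun_prop) ?_
    refine HasCompactSupport.mul_right (((hφs n).fderiv (𝕜 := ℝ)).mono fun x hx hx' => hx ?_)
    simp only [hx', zero_apply]
  have hparts : ∀ n, ∫ x, fderiv ℝ (fun x => χ n x ^ 2 * h x) x (∇ u x) * p x =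
      -(1 / lam) * ∫ x, χ n x ^ 2 * h x * divergence v x := by
    intro n
    rw [integral_mul_divergence (hφ1 n) (hφs n) hv1]
    simp only [hv, map_smul, smul_eq_mul, mul_assoc]
    rw [integral_const_mul]
    field_simp
    exact integral_congr_ae (Eventually.of_forall fun x => mul_comm _ _)
  refine integrable_and_integral_le_of_tendsto
    (f := fun n x => (1 - 1 / ((n : ℝ) + 1)) *
      (χ n x ^ 2 * (k / (u x * (k + u x)) * ‖fderiv ℝ u x‖ ^ 2 * p x)))
    (a := fun n : ℕ => -(1 / lam) * (∫ x, χ n x ^ 2 * h x * divergence v x) +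
      k * c ^ 2 * (1 / ((n : ℝ) + 1)) * ∫ x, p x)
    (fun n => ?_) i1 (fun n x => mul_nonneg (hε n) (mul_nonneg (sq_nonneg _) (hf0 x)))
    (fun x => ?_) (fun n => ?_) ?_
  · exact (((hχ n).continuous.pow 2).mul hfc).measurable.const_mul _
  · simpa using (hε0.const_sub 1).mul (((hχt x).pow 2).mul_const _)
  · rw [← hparts, ← integral_const_mul, ← integral_add (i2 n) (hpi.const_mul _)]
    exact integral_mono (i1 n) ((i2 n).add (hpi.const_mul _)) (key n)
  · have h1 : Tendsto (fun n => ∫ x, χ n x ^ 2 * h x * divergence v x) atTop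
        (𝓝 (∫ x, h x * divergence v x)) := by
      refine tendsto_integral_of_dominated_convergence (fun x => ‖h x * divergence v x‖)
        (fun n => ?_) hwi.norm (fun n => Eventually.of_forall fun x => ?_)
        (Eventually.of_forall fun x => ?_)
      · exact ((hφ1 n).continuous.mul (continuous_divergence hv1)).aestronglyMeasurable
      · rw [mul_assoc, norm_mul, Real.norm_of_nonneg (sq_nonneg _)]
        exact mul_le_of_le_one_left (norm_nonneg _) (pow_le_one₀ (hχ0 n x) (hχ1 n x))
      · simpa using (((hχt x).pow 2).mul_const (h x)).mul_const (divergence v x)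
    simpa using (h1.const_mul (-(1 / lam))).add
      ((hε0.const_mul (k * c ^ 2)).mul_const (∫ x, p x))

/-- Relative entropy dissipation: if `w = ∇ · (λ p ∇u)` has zero mean and `w log u` is integrable,
then the Fisher information of `u` with respect to `p` is finite and at most
`-λ⁻¹ ∫ w log u`. No growth condition on `u`, `p` or their gradients is needed. -/
lemma dissipation {d : ℕ} {lam : ℝ} (hlam : 0 < lam)
    {p u : Params d → ℝ} (hp : ContDiff ℝ 1 p) (hp0 : ∀ x, 0 ≤ p x) (hpi : Integrable p)
    (hu : ContDiff ℝ 2 u) (hu0 : ∀ x, 0 < u x)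
    (hwi : Integrable (divergence fun y => (lam * p y) • ∇ u y))
    (hw0 : ∫ x, divergence (fun y => (lam * p y) • ∇ u y) x = 0)
    (hwl : Integrable fun x => Real.log (u x) * divergence (fun y => (lam * p y) • ∇ u y) x) :
    Integrable (fun x => ‖fderiv ℝ u x‖ ^ 2 / u x * p x) ∧
      ∫ x, ‖fderiv ℝ u x‖ ^ 2 / u x * p x ≤
        -(1 / lam) * ∫ x, Real.log (u x) * divergence (fun y => (lam * p y) • ∇ u y) x := by
  set w := divergence fun y => (lam * p y) • ∇ u y with hw
  have hwm := hwi.aestronglyMeasurable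
  have huc := hu.continuous
  have hpc := hp.continuous
  have hu' := hu.continuous_fderiv (by simp)
  have hk : ∀ k : ℕ, (0 : ℝ) < k + 1 := fun k => by positivity
  have hku : ∀ (k : ℕ) x, (0 : ℝ) < k + 1 + u x := fun k x => add_pos (hk k) (hu0 x)
  have hL : ∀ (k : ℕ) x, Real.log (u x) - Real.log (k + 1 + u x) + Real.log (k + 1) =
      Real.log (u x) - Real.log (1 + u x * (1 / ((k : ℝ) + 1))) := fun k x => by
    have : (1 : ℝ) + u x * (1 / ((k : ℝ) + 1)) = (k + 1 + u x) / (k + 1) := by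
      have := (hk k).ne'
      field_simp
    rw [this, Real.log_div (hku k x).ne' (hk k).ne']
    ring
  have hLb : ∀ (k : ℕ) x, |Real.log (u x) - Real.log (1 + u x * (1 / ((k : ℝ) + 1)))| ≤
      2 * |Real.log (u x)| + Real.log 2 := fun k x => by
    have h0 : 0 ≤ u x * (1 / ((k : ℝ) + 1)) := mul_nonneg (hu0 x).le (by positivity)
    have h1 : u x * (1 / ((k : ℝ) + 1)) ≤ u x := by
      refine mul_le_of_le_one_right (hu0 x).le ?_
      rw [div_le_one (hk k)]; linarith [k.cast_nonneg (α := ℝ)]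
    have h2 := Real.log_nonneg (by linarith : (1 : ℝ) ≤ 1 + u x * (1 / ((k : ℝ) + 1)))
    have h3 := Real.log_le_log (by linarith) (add_le_add_right h1 1)
    have h4 := log_one_add_le (hu0 x)
    refine (abs_sub _ _).trans ?_
    rw [abs_of_nonneg h2]
    linarith
  have hcont : ∀ k : ℕ, Continuous fun x => Real.log (u x) -
      Real.log (1 + u x * (1 / ((k : ℝ) + 1))) := fun k => by
    refine (huc.log fun x => (hu0 x).ne').sub ((by fun_prop : Continuous fun x =>
      1 + u x * (1 / ((k : ℝ) + 1))).log fun x => ?_)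
    have h0 : 0 ≤ u x * (1 / ((k : ℝ) + 1)) := mul_nonneg (hu0 x).le (by positivity)
    linarith
  have hdom : Integrable fun x => (2 * |Real.log (u x)| + Real.log 2) * |w x| := by
    have := (hwl.norm.const_mul 2).add (hwi.norm.const_mul (Real.log 2))
    refine this.congr (Eventually.of_forall fun x => ?_)
    simp only [Pi.add_apply, norm_mul, Real.norm_eq_abs]
    ring
  have hle : ∀ (k : ℕ) x, ‖(Real.log (u x) - Real.log (1 + u x * (1 / ((k : ℝ) + 1)))) * w x‖ ≤
      (2 * |Real.log (u x)| + Real.log 2) * |w x| := fun k x => by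
    rw [norm_mul]
    exact mul_le_mul_of_nonneg_right (hLb k x) (abs_nonneg _)
  have hm : ∀ k : ℕ, AEStronglyMeasurable (fun x => (Real.log (u x) -
      Real.log (1 + u x * (1 / ((k : ℝ) + 1)))) * w x) volume := fun k =>
    (hcont k).aestronglyMeasurable.mul hwm
  have hint : ∀ k : ℕ, Integrable fun x => (Real.log (u x) -
      Real.log (1 + u x * (1 / ((k : ℝ) + 1)))) * w x := fun k =>
    hdom.mono' (hm k) (Eventually.of_forall (hle k))
  have heq : ∀ k : ℕ, (fun x => (Real.log (u x) - Real.log (k + 1 + u x)) * w x) =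
      fun x => (Real.log (u x) - Real.log (1 + u x * (1 / ((k : ℝ) + 1)))) * w x -
        Real.log (k + 1) * w x := fun k => by
    ext x
    rw [← hL]
    ring
  -- The truncated logarithm is shifted by `log k`, which is harmless since `w` has zero mean.
  have htr := fun k : ℕ => truncated_dissipation (k := k + 1) hlam (hk k) hp hp0 hpi hu hu0
    (by rw [← hw, heq]; exact (hint k).sub (hwi.const_mul _))
  have hε0 := tendsto_one_div_add_atTop_nhds_zero_nat (𝕜 := ℝ)
  refine integrable_and_integral_le_of_tendsto
    (f := fun (k : ℕ) x => ((k : ℝ) + 1) / (u x * (k + 1 + u x)) * ‖fderiv ℝ u x‖ ^ 2 * p x)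
    (a := fun k : ℕ => -(1 / lam) * ∫ x, (Real.log (u x) -
      Real.log (1 + u x * (1 / ((k : ℝ) + 1)))) * w x)
    (fun k => ?_) (fun k => (htr k).1) (fun k x => ?_) (fun x => ?_) (fun k => ?_) ?_
  · refine Continuous.measurable ?_
    refine ((continuous_const.div (by fun_prop) fun x => ?_).mul (by fun_prop)).mul hpc
    exact (mul_pos (hu0 x) (hku k x)).ne'
  · exact mul_nonneg (mul_nonneg (div_nonneg (hk k).le (mul_pos (hu0 x) (hku k x)).le)
      (sq_nonneg _)) (hp0 x)
  · have h1 : Tendsto (fun k : ℕ => 1 / (u x * (1 + u x * (1 / ((k : ℝ) + 1))))) atTop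
        (𝓝 (1 / (u x * (1 + u x * 0)))) := by
      refine (tendsto_const_nhds).div (((hε0.const_mul _).const_add 1).const_mul _) ?_
      simpa using (hu0 x).ne'
    have h2 : ∀ k : ℕ, ((k : ℝ) + 1) / (u x * (k + 1 + u x)) =
        1 / (u x * (1 + u x * (1 / ((k : ℝ) + 1)))) := fun k => by
      have := (hk k).ne'
      have := (hku k x).ne'
      have := (hu0 x).ne'
      field_simp
    simp only [h2]
    have h3 := (h1.mul_const (‖fderiv ℝ u x‖ ^ 2)).mul_const (p x)
    have e : 1 / (u x * (1 + u x * 0)) * ‖fderiv ℝ u x‖ ^ 2 = ‖fderiv ℝ u x‖ ^ 2 / u x := by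
      rw [mul_zero, add_zero, mul_one]; ring
    rwa [e] at h3
  · have h1 := (htr k).2
    rw [← hw, heq, integral_sub (hint k) (hwi.const_mul _), integral_const_mul, hw0, mul_zero,
      sub_zero] at h1
    exact h1
  · refine Tendsto.const_mul _ ?_
    refine tendsto_integral_of_dominated_convergence _ hm hdom
      (fun k => Eventually.of_forall (hle k)) (Eventually.of_forall fun x => ?_)
    refine Tendsto.mul_const _ ?_
    have h1 : Tendsto (fun k : ℕ => 1 + u x * (1 / ((k : ℝ) + 1))) atTop (𝓝 1) := by
      simpa using (hε0.const_mul (u x)).const_add 1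
    simpa using ((Real.continuousAt_log one_ne_zero).tendsto.comp h1).const_sub (Real.log (u x))

/-! ### The proximal Gibbs density and the entropy sandwich -/

section Gibbs

variable {d : ℕ} {lam : ℝ} {F : (Params d → ℝ) → ℝ} {dF : (Params d → ℝ) → Params d → ℝ}
  {q : Params d → ℝ}

lemma IsSmoothConvexFunctional.normalizer_pos (hF : IsSmoothConvexFunctional lam F dF)
    (hq : IsDensity q) : 0 < normalizer lam dF q :=
  integral_exp_pos (hF.normalizer_finite q hq)

lemma IsSmoothConvexFunctional.proximalGibbs_pos (hF : IsSmoothConvexFunctional lam F dF)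
    (hq : IsDensity q) (θ : Params d) : 0 < proximalGibbs lam dF q θ :=
  div_pos (Real.exp_pos _) (hF.normalizer_pos hq)

lemma IsSmoothConvexFunctional.contDiff_proximalGibbs (hF : IsSmoothConvexFunctional lam F dF)
    (hq : IsDensity q) : ContDiff ℝ ∞ (proximalGibbs lam dF q) :=
  ((contDiff_const.mul (hF.smooth q hq)).exp).div_const _

lemma IsSmoothConvexFunctional.integrable_proximalGibbs (hF : IsSmoothConvexFunctional lam F dF)
    (hq : IsDensity q) : Integrable (proximalGibbs lam dF q) :=
  (hF.normalizer_finite q hq).div_const _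

lemma IsSmoothConvexFunctional.integral_proximalGibbs (hF : IsSmoothConvexFunctional lam F dF)
    (hq : IsDensity q) : ∫ θ, proximalGibbs lam dF q θ = 1 := by
  have h := hF.normalizer_pos hq
  simp only [proximalGibbs]
  rw [integral_div]
  exact div_self h.ne'

lemma IsSmoothConvexFunctional.log_proximalGibbs (hF : IsSmoothConvexFunctional lam F dF)
    (hq : IsDensity q) (θ : Params d) : Real.log (proximalGibbs lam dF q θ) =
      -(1 / lam) * dF q θ - Real.log (normalizer lam dF q) := by
  rw [proximalGibbs, Real.log_div (Real.exp_pos _).ne' (hF.normalizer_pos hq).ne', Real.log_exp]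

lemma IsSmoothConvexFunctional.fderiv_proximalGibbs (hF : IsSmoothConvexFunctional lam F dF)
    (hq : IsDensity q) (θ : Params d) : fderiv ℝ (proximalGibbs lam dF q) θ =
      (-(1 / lam) * proximalGibbs lam dF q θ) • fderiv ℝ (dF q) θ := by
  have h1 := ((hF.smooth q hq).differentiable (by simp) θ).hasFDerivAt
  have h2 := ((h1.const_mul (-(1 / lam))).exp).mul_const (normalizer lam dF q)⁻¹
  have h3 : proximalGibbs lam dF q = fun θ =>
      Real.exp (-(1 / lam) * dF q θ) * (normalizer lam dF q)⁻¹ := by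
    ext θ; rw [proximalGibbs, div_eq_mul_inv]
  rw [h3, h2.fderiv, smul_smul, smul_smul]
  congr 1
  ring

/-- The flux of the Fokker–Planck equation is `λ p_q ∇(q / p_q)`. -/
lemma IsSmoothConvexFunctional.fokkerPlanckRHS_eq (hF : IsSmoothConvexFunctional lam F dF)
    (hlam : 0 < lam) (hq : IsDensity q) (hq2 : ContDiff ℝ 2 q) :
    fokkerPlanckRHS lam dF q = divergence fun y =>
      (lam * proximalGibbs lam dF q y) • ∇ (fun x => q x / proximalGibbs lam dF q x) y := by
  have hp0 := hF.proximalGibbs_pos hq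
  have hp := hF.contDiff_proximalGibbs hq
  have hq1 : ContDiff ℝ 1 q := hq2.of_le (by norm_num)
  have hV : ContDiff ℝ 1 fun x => ∇ (dF q) x :=
    contDiff_gradient ((hF.smooth q hq).of_le (by norm_cast))
  have hgq : ContDiff ℝ 1 fun x => ∇ q x := contDiff_gradient hq2
  have h1 : (fun y => (lam * proximalGibbs lam dF q y) •
      ∇ (fun x => q x / proximalGibbs lam dF q x) y) =
      fun y => q y • ∇ (dF q) y + lam • ∇ q y := by
    ext1 y
    apply (InnerProductSpace.toDual ℝ (Params d)).injective
    have h2 : fderiv ℝ q y = proximalGibbs lam dF q y •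
        fderiv ℝ (fun x => q x / proximalGibbs lam dF q x) y +
        (q y / proximalGibbs lam dF q y) • fderiv ℝ (proximalGibbs lam dF q) y := by
      have hu : DifferentiableAt ℝ (fun x => q x / proximalGibbs lam dF q x) y :=
        (hq1.div (hp.of_le (by norm_cast)) fun x => (hp0 x).ne').differentiable (by simp) y
      rw [add_comm, ← fderiv_fun_mul hu (hp.differentiable (by simp) y)]
      congr 1
      ext x
      rw [div_mul_cancel₀ _ (hp0 x).ne']
    rw [map_add, map_smulₛₗ, map_smulₛₗ, map_smulₛₗ]
    simp only [toDual_gradient, conj_trivial]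
    conv_rhs => rw [h2, hF.fderiv_proximalGibbs hq]
    rw [smul_add, smul_smul, smul_smul, smul_smul, add_left_comm, ← add_smul]
    have : q y + lam * (q y / proximalGibbs lam dF q y) *
        (-(1 / lam) * proximalGibbs lam dF q y) = 0 := by
      have := (hp0 y).ne'
      field_simp
      ring
    rw [this, zero_smul, add_zero]
  rw [h1]
  ext θ
  have h2 : ContDiff ℝ 1 fun y => q y • ∇ (dF q) y := hq1.smul hV
  have h3 : ContDiff ℝ 1 fun y => lam • ∇ q y := hgq.const_smul lam
  rw [fokkerPlanckRHS, divergence_add (h2.differentiable (by simp) θ)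
    (h3.differentiable (by simp) θ),
    divergence_const_smul _ (hgq.differentiable (by simp) θ), divergence_gradient hq2]

lemma IsDensity.integrable_weight (hq : IsDensity q) :
    Integrable fun θ => (1 + ‖θ‖ ^ 2) * q θ := by
  refine (hq.integrable.add hq.second_moment).congr (Eventually.of_forall fun θ => ?_)
  simp only [Pi.add_apply]
  ring

lemma IsDensity.integrable_mul (hq : IsDensity q) {a : Params d → ℝ} (ha : Continuous a) {C : ℝ}
    (hC : ∀ θ, |a θ| ≤ C * (1 + ‖θ‖ ^ 2)) : Integrable fun θ => a θ * q θ := by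
  refine (hq.integrable_weight.const_mul C).mono'
    (ha.measurable.mul hq.measurable).aestronglyMeasurable (Eventually.of_forall fun θ => ?_)
  rw [norm_mul, Real.norm_of_nonneg (hq.nonneg θ), ← mul_assoc]
  exact mul_le_mul_of_nonneg_right (hC θ) (hq.nonneg θ)

lemma IsSmoothConvexFunctional.integrable_mul (hF : IsSmoothConvexFunctional lam F dF)
    (hq : IsDensity q) {r : Params d → ℝ} (hr : IsDensity r) :
    Integrable fun θ => dF q θ * r θ := by
  obtain ⟨C, hC⟩ := hF.growth
  exact hr.integrable_mul (hF.smooth q hq).continuous (hC q hq)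

lemma IsSmoothConvexFunctional.integral_mul_sub (hF : IsSmoothConvexFunctional lam F dF)
    {q₀ r : Params d → ℝ} (hq₀ : IsDensity q₀) (hq : IsDensity q) (hr : IsDensity r) :
    ∫ θ, dF q₀ θ * (r θ - q θ) = (∫ θ, dF q₀ θ * r θ) - ∫ θ, dF q₀ θ * q θ := by
  rw [← integral_sub (hF.integrable_mul hq₀ hr) (hF.integrable_mul hq₀ hq)]
  simp only [mul_sub]

lemma integral_add_mul_add_mul {f g h : Params d → ℝ} (a b : ℝ) (hf : Integrable f)
    (hg : Integrable g) (hh : Integrable h) :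
    Integrable (fun θ => f θ + a * g θ + b * h θ) ∧
      ∫ θ, (f θ + a * g θ + b * h θ) = (∫ θ, f θ) + a * (∫ θ, g θ) + b * ∫ θ, h θ := by
  have h1 : Integrable fun θ => f θ + a * g θ := hf.add (hg.const_mul a)
  refine ⟨h1.add (hh.const_mul b), ?_⟩
  rw [integral_add h1 (hh.const_mul b), integral_add hf (hg.const_mul a), integral_const_mul,
    integral_const_mul]

/-- Nonnegativity of the relative entropy of `r` with respect to `p_q`. -/
lemma IsSmoothConvexFunctional.relativeEntropy_nonneg (hF : IsSmoothConvexFunctional lam F dF)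
    (hq : IsDensity q) {r : Params d → ℝ} (hr : IsDensity r) :
    0 ≤ negEntropy r + 1 / lam * (∫ θ, dF q θ * r θ) + Real.log (normalizer lam dF q) := by
  obtain ⟨i, e⟩ := integral_add_mul_add_mul (1 / lam) (Real.log (normalizer lam dF q))
    hr.entropy (hF.integrable_mul hq hr) hr.integrable
  have h : ∫ θ, (r θ - proximalGibbs lam dF q θ) ≤ ∫ θ, (r θ * Real.log (r θ) +
      1 / lam * (dF q θ * r θ) + Real.log (normalizer lam dF q) * r θ) := by
    refine integral_mono (hr.integrable.sub (hF.integrable_proximalGibbs hq))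
      i fun θ => ?_
    simp only
    have hp := hF.proximalGibbs_pos hq θ
    rcases (hr.nonneg θ).eq_or_lt with h0 | h0
    · simp only [← h0]
      simpa using hp.le
    · have h1 := Real.log_le_sub_one_of_pos (div_pos hp h0)
      rw [Real.log_div hp.ne' h0.ne', hF.log_proximalGibbs hq] at h1
      have h2 := mul_le_mul_of_nonneg_left h1 h0.le
      rw [mul_sub (r θ) (_ / _), mul_div_cancel₀ _ h0.ne'] at h2
      linarith
  rw [integral_sub hr.integrable (hF.integrable_proximalGibbs hq), hr.integral_eq_one,
    hF.integral_proximalGibbs hq, e, hr.integral_eq_one, mul_one, sub_self] at h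
  exact h

lemma IsSmoothConvexFunctional.log_div_proximalGibbs (hF : IsSmoothConvexFunctional lam F dF)
    (hq : IsDensity q) {θ : Params d} (h0 : 0 < q θ) :
    Real.log (q θ / proximalGibbs lam dF q θ) =
      Real.log (q θ) + 1 / lam * dF q θ + Real.log (normalizer lam dF q) := by
  rw [Real.log_div h0.ne' (hF.proximalGibbs_pos hq θ).ne', hF.log_proximalGibbs hq]
  ring

/-- The upper half of the entropy sandwich: the optimality gap at `q` is at most
`λ` times the relative entropy of `q` with respect to its own proximal Gibbs density. -/
lemma IsSmoothConvexFunctional.objective_sub_le (hF : IsSmoothConvexFunctional lam F dF)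
    (hlam : 0 < lam) (hq : IsDensity q) (hpos : ∀ θ, 0 < q θ) {r : Params d → ℝ}
    (hr : IsDensity r) :
    Integrable (fun θ => q θ * Real.log (q θ / proximalGibbs lam dF q θ)) ∧
      objective lam F q - objective lam F r ≤
        lam * ∫ θ, q θ * Real.log (q θ / proximalGibbs lam dF q θ) := by
  obtain ⟨i, e⟩ := integral_add_mul_add_mul (1 / lam) (Real.log (normalizer lam dF q))
    hq.entropy (hF.integrable_mul hq hq) hq.integrable
  have he : (fun θ => q θ * Real.log (q θ / proximalGibbs lam dF q θ)) = fun θ =>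
      q θ * Real.log (q θ) + 1 / lam * (dF q θ * q θ) +
        Real.log (normalizer lam dF q) * q θ := by
    ext θ
    rw [hF.log_div_proximalGibbs hq (hpos θ)]
    ring
  rw [he]
  refine ⟨i, ?_⟩
  rw [e, hq.integral_eq_one, mul_one]
  have h1 := hF.convex q r hq hr
  rw [hF.integral_mul_sub hq hq hr] at h1
  have h2 := mul_nonneg hlam.le (hF.relativeEntropy_nonneg hq hr)
  have h3 : lam * (1 / lam) = 1 := by field_simp
  simp only [objective, negEntropy] at h2 ⊢
  rw [mul_add, mul_add, ← mul_assoc, h3] at h2 ⊢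
  linarith

/-- A convex functional with `|dF(q)(θ)| ≤ C (1 + ‖θ‖²)` is Lipschitz in the weighted `L¹` norm. -/
lemma IsSmoothConvexFunctional.abs_sub_le (hF : IsSmoothConvexFunctional lam F dF) {C : ℝ}
    (hC : ∀ q, IsDensity q → ∀ θ, |dF q θ| ≤ C * (1 + ‖θ‖ ^ 2)) (hq : IsDensity q)
    {r : Params d → ℝ} (hr : IsDensity r) :
    |F r - F q| ≤ C * ∫ θ, (1 + ‖θ‖ ^ 2) * |r θ - q θ| := by
  have key : ∀ {q r : Params d → ℝ}, IsDensity q → IsDensity r →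
      F q - F r ≤ C * ∫ θ, (1 + ‖θ‖ ^ 2) * |r θ - q θ| := by
    intro q r hq hr
    have h1 := hF.convex q r hq hr
    have h2 : Integrable fun θ => (1 + ‖θ‖ ^ 2) * |r θ - q θ| := by
      refine (hr.integrable_weight.sub hq.integrable_weight).abs.congr
        (Eventually.of_forall fun θ => ?_)
      have : 0 ≤ 1 + ‖θ‖ ^ 2 := by positivity
      simp only [Pi.sub_apply]
      rw [← mul_sub, abs_mul, abs_of_nonneg this]
    have h3 : |∫ θ, dF q θ * (r θ - q θ)| ≤ C * ∫ θ, (1 + ‖θ‖ ^ 2) * |r θ - q θ| := by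
      rw [← integral_const_mul, ← Real.norm_eq_abs]
      refine norm_integral_le_of_norm_le (h2.const_mul C) (Eventually.of_forall fun θ => ?_)
      rw [norm_mul, ← mul_assoc]
      exact mul_le_mul_of_nonneg_right (hC q hq θ) (abs_nonneg _)
    linarith [neg_le_of_abs_le h3]
  rw [abs_sub_le_iff]
  refine ⟨?_, key hq hr⟩
  have := key hr hq
  simpa only [abs_sub_comm] using this

end Gibbs

/-! ### Differentiation along the flow -/

section Flow

variable {d : ℕ} {lam : ℝ} {F : (Params d → ℝ) → ℝ}
  {dF : (Params d → ℝ) → Params d → ℝ} {q : ℝ → Params d → ℝ}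

lemma IsFokkerPlanckFlow.exists_bound (hq : IsFokkerPlanckFlow lam dF q) {t : ℝ} (ht : 0 < t) :
    ∃ G : Params d → ℝ, Integrable G ∧ ∃ ε > 0, ∀ s ∈ Metric.ball t ε, 0 < s ∧ ∀ θ,
      (1 + ‖θ‖ ^ 2 + |Real.log (q s θ)|) * |fokkerPlanckRHS lam dF (q s) θ| ≤ G θ := by
  obtain ⟨G, hG, h⟩ := hq.dominated t ht
  obtain ⟨ε, hε, hb⟩ := Metric.eventually_nhds_iff_ball.1 (h.and (eventually_gt_nhds ht))
  refine ⟨G, hG, ε, hε, fun s hs => ⟨(hb s hs).2, fun θ => ?_⟩⟩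
  have h1 := (hb s hs).1 θ
  rwa [(hq.equation s (hb s hs).2 θ).deriv] at h1

lemma IsFokkerPlanckFlow.hasDerivAt_integral_mul (hq : IsFokkerPlanckFlow lam dF q)
    {t : ℝ} (ht : 0 < t) (hw : Continuous (fokkerPlanckRHS lam dF (q t)))
    {a : Params d → ℝ} (ha : Continuous a) {C : ℝ} (hC : ∀ θ, |a θ| ≤ C * (1 + ‖θ‖ ^ 2)) :
    Integrable (fun θ => a θ * fokkerPlanckRHS lam dF (q t) θ) ∧
      HasDerivAt (fun s => ∫ θ, a θ * q s θ)
        (∫ θ, a θ * fokkerPlanckRHS lam dF (q t) θ) t := by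
  obtain ⟨G, hG, ε, hε, hb⟩ := hq.exists_bound ht
  have hC0 : 0 ≤ C := by
    have := (abs_nonneg _).trans (hC 0)
    simpa using this
  refine hasDerivAt_integral_of_dominated_loc_of_deriv_le (Metric.ball_mem_nhds t hε)
    (F' := fun s θ => a θ * fokkerPlanckRHS lam dF (q s) θ) (bound := fun θ => C * G θ)
    ?_ ((hq.density t ht.le).integrable_mul ha hC) (ha.mul hw).aestronglyMeasurable
    (Eventually.of_forall fun θ s hs => ?_) (hG.const_mul C)
    (Eventually.of_forall fun θ s hs => (hq.equation s (hb s hs).1 θ).const_mul _)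
  · filter_upwards [eventually_gt_nhds ht] with s hs
    exact (ha.measurable.mul (hq.density s hs.le).measurable).aestronglyMeasurable
  · rw [norm_mul]
    refine (mul_le_mul_of_nonneg_right (hC θ) (abs_nonneg _)).trans ?_
    rw [mul_assoc]
    refine mul_le_mul_of_nonneg_left (le_trans ?_ ((hb s hs).2 θ)) hC0
    exact mul_le_mul_of_nonneg_right (le_add_of_nonneg_right (abs_nonneg _)) (abs_nonneg _)

lemma IsFokkerPlanckFlow.hasDerivAt_negEntropy (hq : IsFokkerPlanckFlow lam dF q)
    {t : ℝ} (ht : 0 < t) (hw : Continuous (fokkerPlanckRHS lam dF (q t))) :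
    Integrable (fun θ => (Real.log (q t θ) + 1) * fokkerPlanckRHS lam dF (q t) θ) ∧
      HasDerivAt (fun s => negEntropy (q s))
        (∫ θ, (Real.log (q t θ) + 1) * fokkerPlanckRHS lam dF (q t) θ) t := by
  obtain ⟨G, hG, ε, hε, hb⟩ := hq.exists_bound ht
  refine hasDerivAt_integral_of_dominated_loc_of_deriv_le (Metric.ball_mem_nhds t hε)
    (F' := fun s θ => (Real.log (q s θ) + 1) * fokkerPlanckRHS lam dF (q s) θ) (bound := G)
    ?_ (hq.density t ht.le).entropy ?_ (Eventually.of_forall fun θ s hs => ?_) hG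
    (Eventually.of_forall fun θ s hs => ?_)
  · filter_upwards [eventually_gt_nhds ht] with s hs
    have := (hq.density s hs.le).measurable
    exact (this.mul this.log).aestronglyMeasurable
  · exact ((((hq.contDiff t ht).continuous.log fun θ => (hq.pos t ht θ).ne').add
      continuous_const).mul hw).aestronglyMeasurable
  · rw [norm_mul]
    refine (mul_le_mul_of_nonneg_right ?_ (abs_nonneg _)).trans ((hb s hs).2 θ)
    refine (norm_add_le _ _).trans ?_
    rw [norm_one, Real.norm_eq_abs]
    nlinarith [sq_nonneg ‖θ‖]
  · have h1 := hq.equation s (hb s hs).1 θ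
    have h0 := (hq.pos s (hb s hs).1 θ).ne'
    refine (h1.mul (h1.log h0)).congr_deriv ?_
    field_simp

lemma IsFokkerPlanckFlow.tendsto_weighted (hq : IsFokkerPlanckFlow lam dF q) {t : ℝ}
    (ht : 0 < t) : Tendsto (fun s => ∫ θ, (1 + ‖θ‖ ^ 2) * |q s θ - q t θ|) (𝓝 t) (𝓝 0) := by
  obtain ⟨G, hG, ε, hε, hb⟩ := hq.exists_bound ht
  have h1 : ∀ s ∈ Metric.ball t ε, ∀ θ, (1 + ‖θ‖ ^ 2) * |q s θ - q t θ| ≤ |s - t| * G θ := by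
    intro s hs θ
    have hw : 0 < 1 + ‖θ‖ ^ 2 := by positivity
    have := Convex.norm_image_sub_le_of_norm_deriv_le (f := fun r => q r θ)
      (C := G θ / (1 + ‖θ‖ ^ 2))
      (fun r hr => (hq.equation r (hb r hr).1 θ).differentiableAt) (fun r hr => ?_)
      (convex_ball t ε) (Metric.mem_ball_self hε) hs
    · rw [Real.norm_eq_abs, Real.norm_eq_abs, div_mul_eq_mul_div, le_div_iff₀ hw] at this
      linarith
    · rw [(hq.equation r (hb r hr).1 θ).deriv, le_div_iff₀ hw, mul_comm]
      refine le_trans ?_ ((hb r hr).2 θ)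
      exact mul_le_mul_of_nonneg_right (le_add_of_nonneg_right (abs_nonneg _)) (norm_nonneg _)
  have h2 : Tendsto (fun s => |s - t| * ∫ θ, G θ) (𝓝 t) (𝓝 0) := by
    have : Continuous fun s => |s - t| * ∫ θ, G θ := by fun_prop
    simpa using this.tendsto t
  refine squeeze_zero' (Eventually.of_forall fun s => integral_nonneg fun θ => by positivity) ?_ h2
  filter_upwards [Metric.ball_mem_nhds t hε] with s hs
  rw [← integral_const_mul]
  exact integral_mono_of_nonneg (Eventually.of_forall fun θ => by positivity) (hG.const_mul _)
    (Eventually.of_forall (h1 s hs))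

lemma IsFokkerPlanckFlow.continuousOn_objective (hF : IsSmoothConvexFunctional lam F dF)
    (hq : IsFokkerPlanckFlow lam dF q)
    (hw : ∀ t, 0 < t → Continuous (fokkerPlanckRHS lam dF (q t))) :
    ContinuousOn (fun t => objective lam F (q t)) (Set.Ici 0) := by
  obtain ⟨C, hC⟩ := hF.growth
  have hlim : ∀ {t : ℝ} {l : Filter ℝ}, 0 ≤ t → (∀ᶠ s in l, 0 ≤ s) →
      Tendsto (fun s => ∫ θ, (1 + ‖θ‖ ^ 2) * |q s θ - q t θ|) l (𝓝 0) →
      Tendsto (fun s => F (q s)) l (𝓝 (F (q t))) := by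
    intro t l ht hl h
    rw [tendsto_iff_dist_tendsto_zero]
    refine squeeze_zero' (Eventually.of_forall fun s => dist_nonneg) ?_
      (by simpa using h.const_mul C)
    filter_upwards [hl] with s hs
    exact hF.abs_sub_le hC (hq.density t ht) (hq.density s hs)
  intro t ht
  rcases (Set.mem_Ici.1 ht).eq_or_lt with h0 | h0
  · subst h0
    rw [← continuousWithinAt_Ioi_iff_Ici]
    exact (hlim le_rfl (eventually_mem_nhdsWithin.mono fun s hs => (Set.mem_Ioi.1 hs).le)
      hq.initial).add (hq.initial_entropy.const_mul lam)
  · refine ContinuousAt.continuousWithinAt ?_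
    exact (hlim h0.le ((eventually_gt_nhds h0).mono fun s hs => hs.le)
      (hq.tendsto_weighted h0)).add
      ((hq.hasDerivAt_negEntropy h0 (hw t h0)).2.continuousAt.tendsto.const_mul lam)

end Flow

/-! ### The entropy production inequality -/

/-- The log-Sobolev inequality applied to `√u`, where `u` is a positive probability density with
respect to `p`: relative entropy is at most `1 / (2α)` times the Fisher information. -/
lemma LogSobolev.relativeEntropy_le {d : ℕ} {α : ℝ} {p u : Params d → ℝ} (h : LogSobolev α p)
    (hp : Continuous p) (hp0 : ∀ x, 0 ≤ p x) (hu : ContDiff ℝ 1 u) (hu0 : ∀ x, 0 < u x)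
    (i1 : Integrable fun x => u x * p x) (h1 : ∫ x, u x * p x = 1)
    (i2 : Integrable fun x => u x * Real.log (u x) * p x)
    (i3 : Integrable fun x => ‖fderiv ℝ u x‖ ^ 2 / u x * p x) :
    ∫ x, u x * Real.log (u x) * p x ≤
      1 / (2 * α) * ∫ x, ‖fderiv ℝ u x‖ ^ 2 / u x * p x := by
  have hs : ∀ x, Real.sqrt (u x) ^ 2 = u x := fun x => Real.sq_sqrt (hu0 x).le
  have hd : ∀ x, ‖fderiv ℝ (fun x => Real.sqrt (u x)) x‖ ^ 2 = 1 / 4 * (‖fderiv ℝ u x‖ ^ 2 / u x) :=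
    fun x => by
      rw [((hu.differentiable (by simp) x).hasFDerivAt.sqrt (hu0 x).ne').fderiv, norm_smul, mul_pow,
        Real.norm_eq_abs, sq_abs, div_pow, mul_pow, hs]
      ring
  have key := h.of_contDiff_one hp hp0 (hu.sqrt fun x => (hu0 x).ne') (by simpa only [hs] using i1)
    (by simpa only [hs] using i2) (by simpa only [hd, mul_assoc] using i3.const_mul (1 / 4))
  simp only [hs, hd, h1, Real.log_one, mul_zero, sub_zero, mul_assoc (1 / 4 : ℝ)] at key
  rw [integral_const_mul] at key
  refine key.trans (le_of_eq ?_)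
  ring

end MeanFieldLangevin

open MeanFieldLangevin

theorem theorem1 {d : ℕ} {lam α : ℝ} (hlam : 0 < lam) (hα : 0 < α)
    (F : (MeanFieldLangevin.Params d → ℝ) → ℝ)
    (dF : (MeanFieldLangevin.Params d → ℝ) → MeanFieldLangevin.Params d → ℝ)
    (hF : MeanFieldLangevin.IsSmoothConvexFunctional lam F dF)
    (hLSI : ∀ q, MeanFieldLangevin.IsDensity q →
      MeanFieldLangevin.LogSobolev α (MeanFieldLangevin.proximalGibbs lam dF q))
    (q : ℝ → MeanFieldLangevin.Params d → ℝ)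
    (hq : MeanFieldLangevin.IsFokkerPlanckFlow lam dF q)
    (qstar : MeanFieldLangevin.Params d → ℝ)
    (hqstar : MeanFieldLangevin.IsOptimal lam F qstar) :
    ∀ t : ℝ, 0 ≤ t →
      MeanFieldLangevin.objective lam F (q t) - MeanFieldLangevin.objective lam F qstar ≤
        Real.exp (-2 * α * lam * t) *
          (MeanFieldLangevin.objective lam F (q 0) -
            MeanFieldLangevin.objective lam F qstar) := by
  intro T hT
  have hu2 : ∀ t, 0 < t → ContDiff ℝ 2 fun x => q t x / proximalGibbs lam dF (q t) x :=
    fun t ht => (hq.contDiff t ht).div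
      ((hF.contDiff_proximalGibbs (hq.density t ht.le)).of_le (by norm_cast))
      fun x => (hF.proximalGibbs_pos (hq.density t ht.le) x).ne'
  have hp1 : ∀ t, 0 < t → ContDiff ℝ 1 (proximalGibbs lam dF (q t)) := fun t ht =>
    (hF.contDiff_proximalGibbs (hq.density t ht.le)).of_le (by norm_cast)
  have hwc : ∀ t, 0 < t → Continuous (fokkerPlanckRHS lam dF (q t)) := fun t ht => by
    rw [hF.fokkerPlanckRHS_eq hlam (hq.density t ht.le) (hq.contDiff t ht)]
    exact continuous_divergence
      ((contDiff_const.mul (hp1 t ht)).smul (contDiff_gradient (hu2 t ht)))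
  have hcont := (hq.continuousOn_objective hF hwc).sub
    (continuousOn_const (c := objective lam F qstar))
  have main := le_exp_mul_of_left_majorant (K := 2 * α * lam) hT
    (hcont.mono Set.Icc_subset_Ici_self) ?_
  · simpa only [neg_mul, Pi.sub_apply] using main
  intro t ht _
  have hqt := hq.density t ht.le
  have hpos := hq.pos t ht
  have hp0 := hF.proximalGibbs_pos hqt
  obtain ⟨C, hC⟩ := hF.growth
  set V := dF (q t) with hV
  set p := proximalGibbs lam dF (q t) with hp
  set w := fokkerPlanckRHS lam dF (q t) with hw
  set u : Params d → ℝ := fun x => q t x / p x with hu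
  have hweq : w = divergence fun y => (lam * p y) • ∇ u y :=
    hF.fokkerPlanckRHS_eq hlam hqt (hq.contDiff t ht)
  obtain ⟨iVw, dV⟩ := hq.hasDerivAt_integral_mul ht (hwc t ht) (hF.smooth _ hqt).continuous
    (hC _ hqt)
  obtain ⟨iHw, dH⟩ := hq.hasDerivAt_negEntropy ht (hwc t ht)
  obtain ⟨iw, d1⟩ := hq.hasDerivAt_integral_mul ht (hwc t ht) (a := fun _ => 1) (C := 1)
    continuous_const (fun θ => by simp)
  simp only [one_mul] at iw d1
  have hw0 : ∫ θ, w θ = 0 := by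
    refine d1.unique ((hasDerivAt_const t (1 : ℝ)).congr_of_eventuallyEq ?_)
    filter_upwards [eventually_gt_nhds ht] with s hs
    exact (hq.density s hs.le).integral_eq_one
  have hlog : ∀ x, Real.log (u x) * w x = (Real.log (q t x) + 1) * w x + 1 / lam * (V x * w x) +
      (Real.log (normalizer lam dF (q t)) - 1) * w x := fun x => by
    rw [hu, hF.log_div_proximalGibbs hqt (hpos x)]
    ring
  obtain ⟨ilog, elog⟩ := integral_add_mul_add_mul (1 / lam)
    (Real.log (normalizer lam dF (q t)) - 1) iHw iVw iw
  simp only [← hw, ← hV, ← hlog] at ilog elog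
  have hD : (∫ x, V x * w x) + lam * (∫ x, (Real.log (q t x) + 1) * w x) =
      lam * ∫ x, Real.log (u x) * w x := by
    rw [elog, hw0]
    field_simp
    ring
  -- The majorant of `𝓛(q_s)` linearizes `F` at `q_t` and keeps the entropy as it is.
  refine ⟨fun s => (∫ x, V x * q s x) + lam * negEntropy (q s), _, dV.add (dH.const_mul lam),
    ?_, fun s hs0 hst => ?_⟩
  · rw [hD]
    have hup : ∀ x, u x * p x = q t x := fun x => div_mul_cancel₀ _ (hp0 x).ne'
    have hu0 : ∀ x, 0 < u x := fun x => div_pos (hpos x) (hp0 x)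
    obtain ⟨iI, hI⟩ := dissipation hlam (hp1 t ht) (fun x => (hp0 x).le)
      (hF.integrable_proximalGibbs hqt) (hu2 t ht) hu0 (by rw [← hweq]; exact iw)
      (by rw [← hweq]; exact hw0) (by rw [← hweq]; exact ilog)
    rw [← hweq] at hI
    obtain ⟨iK, hK⟩ := hF.objective_sub_le hlam hqt hpos hqstar.1
    have huK : ∀ x, u x * Real.log (u x) * p x = q t x * Real.log (q t x / p x) := fun x => by
      rw [mul_right_comm, hup]
    have hL := LogSobolev.relativeEntropy_le (p := p) (u := u) (hLSI (q t) hqt)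
      (hp1 t ht).continuous (fun x => (hp0 x).le)
      ((hu2 t ht).of_le (by norm_num)) hu0
      (by simp only [hup]; exact hqt.integrable) (by simp only [hup]; exact hqt.integral_eq_one)
      (by simp only [huK]; exact iK) iI
    simp only [huK] at hL
    set KL := ∫ x, q t x * Real.log (q t x / p x)
    set I := ∫ x, ‖fderiv ℝ u x‖ ^ 2 / u x * p x
    set D := ∫ x, Real.log (u x) * w x
    have h1 : 2 * α * KL ≤ I := by
      have := mul_le_mul_of_nonneg_left hL (by positivity : 0 ≤ 2 * α)
      rwa [← mul_assoc (2 * α) (1 / (2 * α)), mul_one_div_cancel (by positivity), one_mul] at this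
    have h2 : lam * I ≤ -D := by
      have := mul_le_mul_of_nonneg_left hI hlam.le
      rwa [← mul_assoc, mul_neg, mul_one_div_cancel hlam.ne', neg_one_mul] at this
    have h3 := mul_le_mul_of_nonneg_left hK (by positivity : 0 ≤ 2 * α * lam)
    have h4 := mul_le_mul_of_nonneg_left h1 (by positivity : 0 ≤ lam * lam)
    have h5 := mul_le_mul_of_nonneg_left h2 hlam.le
    simp only [Pi.sub_apply]
    linarith
  · have h1 := hF.convex (q t) (q s) hqt (hq.density s hs0)
    rw [hF.integral_mul_sub hqt hqt (hq.density s hs0)] at h1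
    simp only [Pi.sub_apply, objective]
    linarith
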